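/- **Setting.** Let $H$ be an infinite-dimensional real Hilbert space and let $A:D(A)\to H$ be a positive self-adjoint linear operator with compact inverse. Let $\lambda_1\le\lambda_2\le\cdots$ be its eigenvalues, counted with multiplicity, and let $e_1,e_2,\dots$ be corresponding orthonormal eigenvectors. Let $\mathbb H=H\times H$ with $\|(u,v)\|_{\mathbb H}^2=\|u\|^2+\|v\|^2$, and let $\mathbb A=\begin{pmatrix}1&1\\0&1\end{pmatrix}A$, i.e. $\mathbb A(u,v)=(Au+Av,\,Av)$ with domain $D(A)\times D(A)$. Let $\mathbb F:\mathbb H\to\mathbb H$ be globally Lipschitz with constant $L$: $$\|\mathbb F(\xi_1)-\mathbb F(\xi_2)\|_{\mathbb H}\le L\|\xi_1-\xi_2\|_{\mathbb H}\quad\text{for all }\xi_1,\xi_2\in\mathbb H.$$ For $n\ge1$ put $P_nH=\operatorname{span}\{e_1,\dots,e_n\}$, $P_n\mathbb H=P_nH\times P_nH$ (a subspace of dimension $2n$), and let $Q_n\mathbb H$ be its orthogonal complement in $\mathbb H$. A solution of $$\partial_t\xi+\mathbb A\xi=\mathbb F(\xi),\qquad t\ge0,\tag{1}$$ is a mild solution: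 a continuous $\xi:[0,\infty)\to\mathbb H$ such that, for all $t\ge0$, $\int_0^t\xi\,ds\in D(\mathbb A)$ and $\xi(t)-\xi(0)+\mathbb A\int_0^t\xi\,ds=\int_0^t\mathbb F(\xi)\,ds$. **Theorem.** Let $n\ge 1$ be such that $$\frac{(\lambda_{n+1}-\lambda_n)^2}{\lambda_{n+1}+\lambda_n+2\sqrt{\lambda_{n+1}^2-\lambda_n\lambda_{n+1}+\lambda_n^2}}>L .$$ Then (1) has exactly one solution for every initial value in $\mathbb H$, and so generates a solution semigroup $\mathbb S(t)$, $t\ge0$; and (1) possesses a $2n$-dimensional Lipschitz inertial manifold with base $P_n\mathbb H$ whose tracking exponent is $$\theta=\tfrac23(\lambda_{n+1}+\lambda_n)-\tfrac13\sqrt{\lambda_{n+1}^2-\lambda_n\lambda_{n+1}+\lambda_n^2}\;>\;0 .$$ That is, there is a closed set $\mathbb M\subset\mathbb H$ such that 1. $\mathbb S(t)\mathbb M=\mathbb M$ for all $t\ge0$; 2. $\mathbb M=\{p+M(p):p\in P_n\mathbb H\}$ for some globally Lipschitz map $M:P_n\mathbb H\to Q_n\mathbb H$; 3. there is a nondecreasing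 function $Q:\mathbb R\to\mathbb R$ such that for every solution $\xi$ of (1) there is a solution $\bar\xi$ of (1) with $\bar\xi(t)\in\mathbb M$ and $$\|\xi(t)-\bar\xi(t)\|_{\mathbb H}\le Q(\|\xi(0)\|_{\mathbb H})\,e^{-\theta t}\qquad\text{for all }t\ge0.$$ -/

import Mathlib

noncomputable section

/-- The phase space `H × H` with the Hilbert norm `‖(u, v)‖² = ‖u‖² + ‖v‖²`. -/
abbrev PhaseSpace (H : Type*) : Type _ := WithLp 2 (H × H)

section Operators

variable {H : Type*} [NormedAddCommGroup H] [InnerProductSpace ℝ H]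

/-- The subspace `V × V` of the phase space. -/
def prodSelf (V : Submodule ℝ H) : Submodule ℝ (PhaseSpace H) :=
  (V.prod V).comap (WithLp.linearEquiv 2 ℝ (H × H)).toLinearMap

/-- The block operator `[[1, 1], [0, 1]] A`, that is `(u, v) ↦ (A u + A v, A v)`, with domain
`D(A) × D(A)`. -/
def jordanOperator (A : H →ₗ.[ℝ] H) : PhaseSpace H →ₗ.[ℝ] PhaseSpace H where
  domain := prodSelf A.domain
  toFun :=
    { toFun := fun ξ => WithLp.toLp 2
        (A ⟨(ξ : PhaseSpace H).fst, ξ.2.1⟩ + A ⟨(ξ : PhaseSpace H).snd, ξ.2.2⟩,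
          A ⟨(ξ : PhaseSpace H).snd, ξ.2.2⟩)
      map_add' := by
        intro ξ η
        have h1 : A ⟨((ξ + η : prodSelf A.domain) : PhaseSpace H).fst, (ξ + η).2.1⟩
            = A ⟨(ξ : PhaseSpace H).fst, ξ.2.1⟩ + A ⟨(η : PhaseSpace H).fst, η.2.1⟩ := by
          rw [← LinearPMap.map_add]; rfl
        have h2 : A ⟨((ξ + η : prodSelf A.domain) : PhaseSpace H).snd, (ξ + η).2.2⟩
            = A ⟨(ξ : PhaseSpace H).snd, ξ.2.2⟩ + A ⟨(η : PhaseSpace H).snd, η.2.2⟩ := by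
          rw [← LinearPMap.map_add]; rfl
        rw [h1, h2, ← WithLp.toLp_add, Prod.mk_add_mk, add_add_add_comm]
      map_smul' := by
        intro c ξ
        have h1 : A ⟨((c • ξ : prodSelf A.domain) : PhaseSpace H).fst, (c • ξ).2.1⟩
            = c • A ⟨(ξ : PhaseSpace H).fst, ξ.2.1⟩ := by
          rw [← LinearPMap.map_smul]; rfl
        have h2 : A ⟨((c • ξ : prodSelf A.domain) : PhaseSpace H).snd, (c • ξ).2.2⟩
            = c • A ⟨(ξ : PhaseSpace H).snd, ξ.2.2⟩ := by
          rw [← LinearPMap.map_smul]; rfl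
        rw [h1, h2, RingHom.id_apply, ← WithLp.toLp_smul, Prod.smul_mk, smul_add] }

/-- `A : D(A) → H` is bijective and its inverse is a compact operator on `H`. -/
def HasCompactInverse (A : H →ₗ.[ℝ] H) : Prop :=
  ∃ T : H →L[ℝ] H, IsCompactOperator T ∧
    (∀ y : H, ∃ h : T y ∈ A.domain, A ⟨T y, h⟩ = y) ∧ ∀ x : A.domain, T (A x) = x

/-- `lam 1 ≤ lam 2 ≤ …` is the list of all eigenvalues of `A`, each repeated according to its
multiplicity, and `e 1, e 2, …` are corresponding orthonormal eigenvectors. -/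
structure IsEigenEnumeration (A : H →ₗ.[ℝ] H) (lam : ℕ+ → ℝ) (e : ℕ+ → H) : Prop where
  monotone : Monotone lam
  orthonormal : Orthonormal ℝ e
  mem_domain : ∀ k, e k ∈ A.domain
  eigen : ∀ k, A ⟨e k, mem_domain k⟩ = lam k • e k
  exhaustive : ∀ (μ : ℝ) (x : A.domain), A x = μ • (x : H) →
    (x : H) ∈ Submodule.span ℝ (e '' {k | lam k = μ})

/-- `P_n H × P_n H`, where `P_n H` is the span of the first `n` eigenvectors. -/
def baseSpace (e : ℕ+ → H) (n : ℕ+) : Submodule ℝ (PhaseSpace H) :=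
  prodSelf (Submodule.span ℝ (e '' Set.Iic n))

end Operators

section Dynamics

variable {E : Type*} [NormedAddCommGroup E] [InnerProductSpace ℝ E]

/-- `ξ` is a (mild) solution on `[0, ∞)` of `ξ' + B ξ = F ξ`: it is continuous with values in `E`,
and `ξ t - ξ 0 + B (∫₀ᵗ ξ) = ∫₀ᵗ F (ξ)` for all `t ≥ 0`, the integral of `ξ` being in `D(B)`.
The values of `ξ` at negative times play no role. -/
structure IsMildSolution (B : E →ₗ.[ℝ] E) (F : E → E) (ξ : ℝ → E) : Prop where
  continuousOn : ContinuousOn ξ (Set.Ici 0)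
  integral_mem : ∀ t : ℝ, 0 ≤ t → (∫ s in (0 : ℝ)..t, ξ s) ∈ B.domain
  equation : ∀ (t : ℝ) (ht : 0 ≤ t),
    ξ t - ξ 0 + B ⟨∫ s in (0 : ℝ)..t, ξ s, integral_mem t ht⟩ = ∫ s in (0 : ℝ)..t, F (ξ s)

/-- `S t`, `t ≥ 0`, is the solution semigroup of `ξ' + B ξ = F ξ`: for every `ξ₀` the curve
`t ↦ S t ξ₀` is the unique solution starting at `ξ₀`. -/
structure IsSolutionSemigroup (B : E →ₗ.[ℝ] E) (F : E → E) (S : ℝ → E → E) : Prop where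
  initial : ∀ ξ₀, S 0 ξ₀ = ξ₀
  solution : ∀ ξ₀, IsMildSolution B F (fun t => S t ξ₀)
  unique : ∀ ξ : ℝ → E, IsMildSolution B F ξ → ∀ t : ℝ, 0 ≤ t → ξ t = S t (ξ 0)

/-- `W` is an inertial manifold with base `V` for `ξ' + B ξ = F ξ` (with solution semigroup `S`),
with exponent `θ` in the exponential tracking property. -/
structure IsInertialManifold (B : E →ₗ.[ℝ] E) (F : E → E) (S : ℝ → E → E)
    (V : Submodule ℝ E) (θ : ℝ) (W : Set E) : Prop where
  isClosed : IsClosed W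
  invariant : ∀ t : ℝ, 0 ≤ t → S t '' W = W
  lipschitz_graph : ∃ (M : V → Vᗮ) (K : NNReal), LipschitzWith K M ∧
    W = Set.range (fun p : V => (p : E) + (M p : E))
  exponent_pos : 0 < θ
  tracking : ∃ Q : ℝ → ℝ, Monotone Q ∧ ∀ ξ : ℝ → E, IsMildSolution B F ξ →
    ∃ η : ℝ → E, IsMildSolution B F η ∧ (∀ t : ℝ, 0 ≤ t → η t ∈ W) ∧
      ∀ t : ℝ, 0 ≤ t → ‖ξ t - η t‖ ≤ Q ‖ξ 0‖ * Real.exp (-θ * t)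

end Dynamics

end

/-! The eigenvectors of `A` form a Hilbert basis of `H`, in which the equation splits into planar
systems u' = -λ(u + v) + g, v' = -λv + h, one for each eigenvalue λ, coupled only through the source
`F`. Everything rests on one indefinite diagonal quadratic form V. Its mode terms are c²/α u² + α v²
above the gap and -(c²/β) u² - β v² below it, where α = λ_{n+1} - θ, β = θ - λ_n and c is the left
side of the gap condition. Unequal weights for u and v absorb the Jordan coupling.

Completing squares in each mode gives d/dt(e^{2θt} V) ≤ e^{2θt}(‖g‖² - c²‖ξ‖²). For the difference
of two solutions ‖g‖ ≤ L‖ξ‖ with L < c, so the time-τ map f satisfies the strong cone condition μ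
V(f x - f y) + κ‖f x - f y‖² ≤ V(x - y) with μ = e^{2θτ} and κ > 0 (`IsModalFlow.strong_cone`).

The rest is discrete and geometric. The manifold is the set of points with a backward orbit growing
more slowly than μ^{k/2}. Iterating the cone condition backwards makes V strictly negative on
differences of such points, so they form a Lipschitz graph over the base
(`IsConeMap.slowSet_strict_cone`). A point over each base vector is a limit of finite orbit segments
that start in P (`IsConeMap.exists_mem_slowSet`). Finally, a compactness argument finds for each x a
slow point w such that V(f^k x - f^k w) ≥ 0 for all k. Along such a pair the cone condition forces
decay at rate μ^{-k/2}, that is e^{-θt} (`IsConeMap.exists_tracking`). The characterisation by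
growth is inherited under maps commuting with f, which gives invariance for all real times. -/

open Filter Topology

/-! ### Discrete theory: invariant graphs from the strong cone condition. -/

section Cone

variable {E : Type*} [NormedAddCommGroup E] [InnerProductSpace ℝ E]

/-- The quadratic form `x ↦ ⟪T x, x⟫` of a bounded operator. -/
def coneForm (T : E →L[ℝ] E) (x : E) : ℝ := inner ℝ (T x) x

/-- `T` is symmetric, leaves `P` invariant, and its quadratic form is negative definite on `P` and
positive definite on the orthogonal complement of `P`. -/
structure IsConeOperator (P : Submodule ℝ E) (T : E →L[ℝ] E) (m : ℝ) : Prop where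
  symm : ∀ x y, inner ℝ (T x) y = inner ℝ x (T y)
  invariant : ∀ p ∈ P, T p ∈ P
  pos : 0 < m
  neg_on : ∀ p ∈ P, coneForm T p ≤ -m * ‖p‖ ^ 2
  pos_on : ∀ q ∈ Pᗮ, m * ‖q‖ ^ 2 ≤ coneForm T q

/-- `f` is Lipschitz and satisfies the strong cone condition, with factor `μ`, for the quadratic
form of `T`; on `P` it is close to the identity. -/
structure IsConeMap (P : Submodule ℝ E) [P.HasOrthogonalProjection] (T : E →L[ℝ] E)
    (m μ κ : ℝ) (f : E → E) : Prop where
  cone : IsConeOperator P T m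
  one_lt : 1 < μ
  gain_pos : 0 < κ
  lipschitz : ∃ K : NNReal, LipschitzWith K f
  strong_cone : ∀ x y,
    μ * coneForm T (f x - f y) + κ * ‖f x - f y‖ ^ 2 ≤ coneForm T (x - y)
  near_id : ∃ η : ℝ, 0 ≤ η ∧ η * Real.sqrt (1 + ‖T‖ / m) < 1 ∧
    ∀ x y, ‖P.starProjection (f x - f y) - P.starProjection (x - y)‖ ≤ η * ‖x - y‖

/-- The points possessing a backward orbit of `f` that grows more slowly than `μ ^ (k / 2)`. -/
def slowSet (f : E → E) (μ : ℝ) : Set E :=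
  {x | ∃ X : ℕ → E, X 0 = x ∧ (∀ k, f (X (k + 1)) = X k) ∧
    Tendsto (fun k => (μ⁻¹) ^ k * ‖X k‖ ^ 2) atTop (𝓝 0)}

theorem abs_inner_clm_le (T : E →L[ℝ] E) (x y : E) : |inner ℝ (T x) y| ≤ ‖T‖ * ‖x‖ * ‖y‖ :=
  (abs_real_inner_le_norm _ _).trans (mul_le_mul_of_nonneg_right (T.le_opNorm x) (norm_nonneg _))

theorem abs_coneForm_le (T : E →L[ℝ] E) (x : E) : |coneForm T x| ≤ ‖T‖ * ‖x‖ ^ 2 := by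
  have := abs_inner_clm_le T x x
  rw [sq, ← mul_assoc]; exact this

theorem continuous_coneForm (T : E →L[ℝ] E) : Continuous (coneForm T) := by
  unfold coneForm; fun_prop

@[simp] theorem coneForm_neg (T : E →L[ℝ] E) (x : E) : coneForm T (-x) = coneForm T x := by
  simp [coneForm]

/-- Summation of a one-step energy inequality along a finite orbit. -/
theorem backward_energy {a d : ℕ → ℝ} {q κ C : ℝ} (hq : 0 ≤ q) {k : ℕ}
    (h : ∀ i < k, a i + κ * q * d i ≤ q * a (i + 1) + q * C) :
    a 0 + κ * ∑ i ∈ Finset.range k, q ^ (i + 1) * d i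
      ≤ q ^ k * a k + C * ∑ i ∈ Finset.range k, q ^ (i + 1) := by
  induction k with
  | zero => simp
  | succ k ih =>
    have h1 := ih fun i hi => h i (by omega)
    have h2 := mul_le_mul_of_nonneg_left (h k (by omega)) (pow_nonneg hq k)
    rw [Finset.sum_range_succ, Finset.sum_range_succ]
    have e1 : q ^ k * (a k + κ * q * d k) = q ^ k * a k + κ * (q ^ (k + 1) * d k) := by ring
    have e2 : q ^ k * (q * a (k + 1) + q * C) = q ^ (k + 1) * a (k + 1) + C * q ^ (k + 1) := by ring
    rw [e1, e2] at h2
    linarith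

theorem sum_pow_succ_le {q : ℝ} (h0 : 0 ≤ q) (h1 : q < 1) (k : ℕ) :
    ∑ i ∈ Finset.range k, q ^ (i + 1) ≤ (1 - q)⁻¹ := by
  have h := (summable_geometric_of_lt_one h0 h1).sum_le_tsum (Finset.range k)
    (fun i _ => pow_nonneg h0 i)
  rw [tsum_geometric_of_lt_one h0 h1] at h
  refine le_trans (Finset.sum_le_sum fun i _ => ?_) h
  exact pow_le_pow_of_le_one h0 h1.le (Nat.le_succ i)

theorem backward_energy_single {a d : ℕ → ℝ} {q κ C : ℝ} (hq : 0 ≤ q) (hq1 : q < 1)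
    (hκ : 0 ≤ κ) (hC : 0 ≤ C) (hd : ∀ i, 0 ≤ d i) {k : ℕ}
    (h : ∀ i < k, a i + κ * q * d i ≤ q * a (i + 1) + q * C) {j : ℕ} (hj : j < k) :
    a 0 + κ * (q ^ (j + 1) * d j) ≤ q ^ k * a k + C * (1 - q)⁻¹ := by
  have h1 := backward_energy hq h
  have h2 : q ^ (j + 1) * d j ≤ ∑ i ∈ Finset.range k, q ^ (i + 1) * d i :=
    Finset.single_le_sum (f := fun i => q ^ (i + 1) * d i)
      (fun i _ => mul_nonneg (pow_nonneg hq _) (hd i)) (Finset.mem_range.2 hj)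
  have h3 := mul_le_mul_of_nonneg_left h2 hκ
  have h4 := mul_le_mul_of_nonneg_left (sum_pow_succ_le hq hq1 k) hC
  linarith

namespace IsConeOperator

variable {P : Submodule ℝ E} {T : E →L[ℝ] E} {m : ℝ} (hT : IsConeOperator P T m)
include hT

theorem coneForm_add (x y : E) :
    coneForm T (x + y) = coneForm T x + 2 * inner ℝ (T x) y + coneForm T y := by
  have h : inner ℝ (T y) x = inner ℝ (T x) y := by rw [hT.symm, real_inner_comm]
  simp only [coneForm, map_add, inner_add_left, inner_add_right, h]
  ring

variable [P.HasOrthogonalProjection]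

theorem coneForm_split (x : E) :
    coneForm T x = coneForm T (P.starProjection x) + coneForm T (x - P.starProjection x) := by
  have h := hT.coneForm_add (P.starProjection x) (x - P.starProjection x)
  have h0 : inner ℝ (T (P.starProjection x)) (x - P.starProjection x) = 0 :=
    (Submodule.mem_orthogonal _ _).1 (Submodule.sub_starProjection_mem_orthogonal x) _
      (hT.invariant _ (Submodule.starProjection_apply_mem _ _))
  rw [add_sub_cancel, h0] at h
  linarith

theorem coneForm_le_norm_compl (x : E) :
    coneForm T x ≤ ‖T‖ * ‖x - P.starProjection x‖ ^ 2 := by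
  have h1 := hT.coneForm_split x
  have h2 := hT.neg_on _ (Submodule.starProjection_apply_mem P x)
  have h3 := (le_abs_self _).trans (abs_coneForm_le T (x - P.starProjection x))
  have h4 : 0 ≤ m * ‖P.starProjection x‖ ^ 2 := mul_nonneg hT.pos.le (sq_nonneg _)
  linarith

theorem neg_le_coneForm (x : E) : -(‖T‖ * ‖P.starProjection x‖ ^ 2) ≤ coneForm T x := by
  have h1 := hT.coneForm_split x
  have h2 := hT.pos_on _ (Submodule.sub_starProjection_mem_orthogonal x)
  have h3 := neg_le_of_abs_le (abs_coneForm_le T (P.starProjection x))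
  have h4 : 0 ≤ m * ‖x - P.starProjection x‖ ^ 2 := mul_nonneg hT.pos.le (sq_nonneg _)
  linarith

theorem coneForm_nonneg_of_projection_eq_zero {x : E} (h : P.starProjection x = 0) :
    0 ≤ coneForm T x := by
  simpa [h] using hT.neg_le_coneForm x

omit hT in
theorem norm_sq_split (x : E) :
    ‖x‖ ^ 2 = ‖P.starProjection x‖ ^ 2 + ‖x - P.starProjection x‖ ^ 2 := by
  have h : inner ℝ (P.starProjection x) (x - P.starProjection x) = 0 :=
    (Submodule.mem_orthogonal _ _).1 (Submodule.sub_starProjection_mem_orthogonal x) _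
      (Submodule.starProjection_apply_mem _ _)
  have := norm_add_sq_real (P.starProjection x) (x - P.starProjection x)
  rw [add_sub_cancel, h] at this
  linarith

/-- With x = p + q along P and its complement, m‖q‖² ≤ V(q) ≤ -V(p) ≤ ‖T‖‖p‖². This is the source of
every Lipschitz bound for graphs over P. -/
theorem norm_le_of_coneForm_nonpos {x : E} (hx : coneForm T x ≤ 0) :
    ‖x‖ ≤ Real.sqrt (1 + ‖T‖ / m) * ‖P.starProjection x‖ := by
  have h1 := hT.coneForm_split x
  have h2 := hT.pos_on _ (Submodule.sub_starProjection_mem_orthogonal x)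
  have h3 := neg_le_of_abs_le (abs_coneForm_le T (P.starProjection x))
  have h4 : ‖x - P.starProjection x‖ ^ 2 ≤ ‖T‖ / m * ‖P.starProjection x‖ ^ 2 := by
    rw [div_mul_eq_mul_div, le_div_iff₀ hT.pos]; linarith
  have hnn : 0 ≤ 1 + ‖T‖ / m := by have := hT.pos; positivity
  refine abs_le_of_sq_le_sq' ?_ (by positivity) |>.2
  rw [mul_pow, Real.sq_sqrt hnn, norm_sq_split (P := P) x]
  linarith

end IsConeOperator

namespace IsConeMap

variable {P : Submodule ℝ E} [P.HasOrthogonalProjection] {T : E →L[ℝ] E} {m μ κ : ℝ} {f : E → E}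
  (hf : IsConeMap P T m μ κ f)
include hf

theorem coneForm_step_nonpos {x y : E} (h : coneForm T (x - y) ≤ 0) :
    coneForm T (f x - f y) ≤ 0 := by
  have h1 := hf.strong_cone x y
  have h2 : 0 ≤ κ * ‖f x - f y‖ ^ 2 := mul_nonneg hf.gain_pos.le (sq_nonneg _)
  have h3 : 0 < μ := zero_lt_one.trans hf.one_lt
  by_contra hc
  have := mul_pos h3 (not_le.1 hc)
  linarith

theorem coneForm_nonneg_of_step {x y : E} (h : 0 ≤ coneForm T (f x - f y)) :
    0 ≤ coneForm T (x - y) := by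
  have h1 := hf.strong_cone x y
  have h2 : 0 ≤ κ * ‖f x - f y‖ ^ 2 := mul_nonneg hf.gain_pos.le (sq_nonneg _)
  have h3 := mul_nonneg (zero_lt_one.trans hf.one_lt).le h
  linarith

theorem inv_lt_one : μ⁻¹ < 1 := inv_lt_one_of_one_lt₀ hf.one_lt

theorem inv_pos : 0 < μ⁻¹ := _root_.inv_pos.2 (zero_lt_one.trans hf.one_lt)

theorem strong_cone_inv (x y : E) :
    coneForm T (f x - f y) + κ * μ⁻¹ * ‖f x - f y‖ ^ 2 ≤ μ⁻¹ * coneForm T (x - y) := by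
  have h := mul_le_mul_of_nonneg_left (hf.strong_cone x y) hf.inv_pos.le
  have h3 : μ⁻¹ * μ = 1 := inv_mul_cancel₀ (zero_lt_one.trans hf.one_lt).ne'
  rw [mul_add, ← mul_assoc, h3] at h
  linarith

theorem iterate_nonpos {x y : E} (h : coneForm T (x - y) ≤ 0) (k : ℕ) :
    coneForm T (f^[k] x - f^[k] y) ≤ 0 := by
  induction k with
  | zero => simpa
  | succ k ih =>
    rw [Function.iterate_succ_apply', Function.iterate_succ_apply']
    exact hf.coneForm_step_nonpos ih

/-- Along two backward orbits of length `k`. -/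
theorem orbit_energy {X Y : ℕ → E} {k : ℕ} (hX : ∀ j < k, f (X (j + 1)) = X j)
    (hY : ∀ j < k, f (Y (j + 1)) = Y j) {j : ℕ} (hj : j < k) :
    coneForm T (X 0 - Y 0) + κ * ((μ⁻¹) ^ (j + 1) * ‖X j - Y j‖ ^ 2)
      ≤ (μ⁻¹) ^ k * coneForm T (X k - Y k) := by
  have h := backward_energy_single (a := fun i => coneForm T (X i - Y i))
    (d := fun i => ‖X i - Y i‖ ^ 2) (C := 0) hf.inv_pos.le hf.inv_lt_one hf.gain_pos.le le_rfl
    (fun i => sq_nonneg _) (k := k) (fun i hi => by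
      have := hf.strong_cone_inv (X (i + 1)) (Y (i + 1))
      rw [hX i hi, hY i hi] at this
      simpa using this) hj
  simpa using h

/-- In the energy inequality along two backward orbits the far end contributes μ^{-k} V(X_k - Y_k),
which vanishes in the limit precisely because both orbits are slow. -/
theorem slowSet_strict_cone {x y : E} (hx : x ∈ slowSet f μ) (hy : y ∈ slowSet f μ) :
    coneForm T (x - y) + κ * μ⁻¹ * ‖x - y‖ ^ 2 ≤ 0 := by
  obtain ⟨X, rfl, hX, hX0⟩ := hx
  obtain ⟨Y, rfl, hY, hY0⟩ := hy
  have hlim : Tendsto (fun k => (2 * ‖T‖) * ((μ⁻¹) ^ k * ‖X k‖ ^ 2 + (μ⁻¹) ^ k * ‖Y k‖ ^ 2))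
      atTop (𝓝 0) := by
    simpa using (hX0.add hY0).const_mul (2 * ‖T‖)
  refine ge_of_tendsto hlim ?_
  filter_upwards [eventually_gt_atTop 0] with k hk
  have h := hf.orbit_energy (fun j _ => hX j) (fun j _ => hY j) hk
  have h1 := (le_abs_self _).trans (abs_coneForm_le T (X k - Y k))
  have h2 : ‖X k - Y k‖ ^ 2 ≤ 2 * (‖X k‖ ^ 2 + ‖Y k‖ ^ 2) := by
    have := norm_sub_le (X k) (Y k)
    nlinarith [norm_nonneg (X k - Y k), sq_nonneg (‖X k‖ - ‖Y k‖)]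
  have h3 := mul_le_mul_of_nonneg_left
    (h1.trans (mul_le_mul_of_nonneg_left h2 (norm_nonneg T))) (pow_nonneg hf.inv_pos.le k)
  simp only [zero_add, pow_one] at h
  linarith

theorem slowSet_norm_le {x y : E} (hx : x ∈ slowSet f μ) (hy : y ∈ slowSet f μ) :
    ‖x - y‖ ≤ Real.sqrt (1 + ‖T‖ / m) * ‖P.starProjection x - P.starProjection y‖ := by
  rw [← map_sub]
  refine hf.cone.norm_le_of_coneForm_nonpos ?_
  have := hf.slowSet_strict_cone hx hy
  have h2 : 0 ≤ κ * μ⁻¹ * ‖x - y‖ ^ 2 :=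
    mul_nonneg (mul_nonneg hf.gain_pos.le hf.inv_pos.le) (sq_nonneg _)
  linarith

/-- The iterates of `P` project onto `P`. -/
theorem exists_iterate_projection_eq [CompleteSpace P] (k : ℕ) :
    ∀ p ∈ P, ∃ x ∈ P, P.starProjection (f^[k] x) = p := by
  induction k with
  | zero => exact fun p hp => ⟨p, hp, Submodule.starProjection_eq_self_iff.2 hp⟩
  | succ k ih =>
    intro p hp
    choose! g hgP hg using ih
    obtain ⟨η, hη0, hη1, hη⟩ := hf.near_id
    set s := Real.sqrt (1 + ‖T‖ / m) with hs
    have hs0 : 0 ≤ s := Real.sqrt_nonneg _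
    let G : P → E := fun z => f^[k] (g z)
    have hG : ∀ z : P, P.starProjection (G z) = z := fun z => hg z z.2
    have hGlip : ∀ z w : P, ‖G z - G w‖ ≤ s * ‖z - w‖ := by
      intro z w
      have h1 : coneForm T (g z - g w) ≤ 0 := by
        have := hf.cone.neg_on _ (P.sub_mem (hgP z z.2) (hgP w w.2))
        have h2 := mul_nonneg hf.cone.pos.le (sq_nonneg ‖g z - g w‖)
        linarith
      have h2 := hf.cone.norm_le_of_coneForm_nonpos (hf.iterate_nonpos h1 k)
      have h3 : P.starProjection (G z - G w) = ((z - w : P) : E) := by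
        rw [map_sub, hG, hG]; rfl
      change ‖G z - G w‖ ≤ s * ‖P.starProjection (G z - G w)‖ at h2
      rw [h3] at h2
      exact h2
    -- `G z` is the point of f^k(P) over z. Fixed points of Φ solve P f(G z) = p. Since differences
    -- in f^k(P) stay in the cone, `G` is Lipschitz with constant s, and Φ contracts by η s < 1.
    let Φ : P → P := fun z =>
      ⟨p - P.starProjection (f (G z)) + z, P.add_mem
        (P.sub_mem hp (Submodule.starProjection_apply_mem _ _)) z.2⟩
    have hΦ : ContractingWith (η * s).toNNReal Φ := by
      refine ⟨Real.toNNReal_lt_one.2 hη1, LipschitzWith.of_dist_le_mul fun z w => ?_⟩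
      rw [dist_eq_norm, dist_eq_norm, Real.coe_toNNReal _ (mul_nonneg hη0 hs0)]
      have e : ((Φ z - Φ w : P) : E)
          = -(P.starProjection (f (G z) - f (G w)) - P.starProjection (G z - G w)) := by
        simp only [Φ, AddSubgroupClass.coe_sub, map_sub, hG]
        abel
      have h1 := hη (G z) (G w)
      have h2 := mul_le_mul_of_nonneg_left (hGlip z w) hη0
      rw [Submodule.coe_norm (Φ z - Φ w), e, norm_neg]
      linarith
    have hfix := congrArg (fun z : P => (z : E)) hΦ.fixedPoint_isFixedPt.eq
    set z := ContractingWith.fixedPoint Φ hΦ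
    refine ⟨g z, hgP z z.2, ?_⟩
    rw [Function.iterate_succ_apply']
    change P.starProjection (f (G z)) = p
    have h4 : p - P.starProjection (f (G z)) + (z : E) = z := hfix
    have h5 : p - P.starProjection (f (G z)) = 0 := by simpa using h4
    exact (sub_eq_zero.1 h5).symm

/-- Energy inequality for a single orbit, with a slightly smaller factor. -/
theorem exists_single_energy : ∃ ν κ' C : ℝ, 1 < ν ∧ ν < μ ∧ 0 < κ' ∧ 0 ≤ C ∧
    ∀ x, ν * coneForm T (f x) + κ' * ‖f x‖ ^ 2 ≤ coneForm T x + C := by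
  have hκ := hf.gain_pos
  have hμ := hf.one_lt
  have hμ0 : 0 < μ := zero_lt_one.trans hμ
  have hT0 := norm_nonneg T
  set N := ‖T‖ + 1 with hN
  have hN0 : 0 < N := by positivity
  -- The first entry of the maximum keeps ν above 1. The second makes (μ - ν)‖T‖ ≤ κ/8, so passing
  -- from μ to ν costs at most κ/8 ‖f x‖². The constant collects the price of comparing f x with f
  -- 0: half of κ‖f x - f 0‖² pays for Young's inequality, the other half leaves κ/4 ‖f x‖².
  refine ⟨max ((1 + μ) / 2) (μ - κ / (8 * N)), κ / 8,
    (2 * μ ^ 2 * ‖T‖ ^ 2 / κ + μ * ‖T‖ + κ / 2) * ‖f 0‖ ^ 2,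
    lt_max_of_lt_left (by linarith), max_lt (by linarith) ?_, by positivity, by positivity, ?_⟩
  · have : 0 < κ / (8 * N) := by positivity
    linarith
  intro x
  set ν := max ((1 + μ) / 2) (μ - κ / (8 * N))
  have hν : (μ - ν) * ‖T‖ ≤ κ / 8 := by
    have h1 : μ - ν ≤ κ / (8 * N) := by
      have := le_max_right ((1 + μ) / 2) (μ - κ / (8 * N)); linarith
    calc (μ - ν) * ‖T‖ ≤ κ / (8 * N) * N := by
          refine mul_le_mul h1 (by linarith) hT0 (by positivity)
      _ = κ / 8 := by field_simp
  have hνμ : 0 ≤ μ - ν := by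
    have : ν ≤ μ := max_le (by linarith) (by have : 0 < κ / (8 * N) := by positivity
                                             linarith)
    linarith
  set a := f x
  set b := f 0
  have h0 := hf.strong_cone x 0
  rw [sub_zero] at h0
  have h1 : coneForm T a = coneForm T (a - b) + 2 * inner ℝ (T (a - b)) b + coneForm T b := by
    rw [← hf.cone.coneForm_add, sub_add_cancel]
  have h2 := (le_abs_self _).trans (abs_inner_clm_le T (a - b) b)
  have h3 := (le_abs_self _).trans (abs_coneForm_le T b)
  have h4 := (neg_le_abs _).trans (abs_coneForm_le T a)
  have h5 : ‖a‖ ^ 2 ≤ 2 * ‖a - b‖ ^ 2 + 2 * ‖b‖ ^ 2 := by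
    have : ‖a‖ ≤ ‖a - b‖ + ‖b‖ := by simpa using norm_add_le (a - b) b
    nlinarith [norm_nonneg a, sq_nonneg (‖a - b‖ - ‖b‖)]
  have h6 : 2 * μ * (‖T‖ * ‖a - b‖ * ‖b‖)
      ≤ κ / 2 * ‖a - b‖ ^ 2 + 2 * μ ^ 2 * ‖T‖ ^ 2 / κ * ‖b‖ ^ 2 := by
    have e : κ / 2 * ‖a - b‖ ^ 2 + 2 * μ ^ 2 * ‖T‖ ^ 2 / κ * ‖b‖ ^ 2
        - 2 * μ * (‖T‖ * ‖a - b‖ * ‖b‖)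
        = (κ * ‖a - b‖ - 2 * μ * ‖T‖ * ‖b‖) ^ 2 / (2 * κ) := by
      field_simp; ring
    have : 0 ≤ (κ * ‖a - b‖ - 2 * μ * ‖T‖ * ‖b‖) ^ 2 / (2 * κ) := by positivity
    linarith
  have h7 : ν * coneForm T a ≤ μ * coneForm T a + κ / 8 * ‖a‖ ^ 2 := by
    have e1 := mul_le_mul_of_nonneg_left h4 hνμ
    have e2 := mul_le_mul_of_nonneg_right hν (sq_nonneg ‖a‖)
    linarith
  have h8 := mul_le_mul_of_nonneg_left h2 (by positivity : 0 ≤ 2 * μ)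
  have h9 := mul_le_mul_of_nonneg_left h3 hμ0.le
  have h10 := mul_le_mul_of_nonneg_left h5 (by positivity : 0 ≤ κ / 4)
  have h11 : μ * coneForm T a
      = μ * coneForm T (a - b) + 2 * μ * inner ℝ (T (a - b)) b + μ * coneForm T b := by
    rw [h1]; ring
  linarith

/-- Take orbit segments of length k from P to points over p, indexed backwards in time. The energy
inequality with some ν < μ bounds them by ν^{j/2} uniformly in k. The cone condition with μ then
makes two segments differ by O((ν/μ)^{k/2}) at each fixed j, so they converge to a full backward
orbit with growth ν^{j/2}. -/
theorem exists_mem_slowSet [CompleteSpace E] [CompleteSpace P] {p : E} (hp : p ∈ P) :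
    ∃ x ∈ slowSet f μ, P.starProjection x = p := by
  obtain ⟨ν, κ', C, hν1, hνμ, hκ', hC, hν⟩ := hf.exists_single_energy
  obtain ⟨K, hK⟩ := hf.lipschitz
  have hν0 : 0 < ν := zero_lt_one.trans hν1
  have hμ0 : 0 < μ := zero_lt_one.trans hf.one_lt
  have hκ := hf.gain_pos
  choose x hxP hx using fun k => hf.exists_iterate_projection_eq k p hp
  let X : ℕ → ℕ → E := fun k j => f^[k - j] (x k)
  have hXstep : ∀ k, ∀ j < k, f (X k (j + 1)) = X k j := by
    intro k j hj
    have : k - j = (k - (j + 1)) + 1 := by omega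
    simp only [X]
    rw [this, Function.iterate_succ_apply']
  have hX0 : ∀ k, P.starProjection (X k 0) = p := fun k => by simpa [X] using hx k
  have hXk : ∀ k, X k k = x k := fun k => by simp [X]
  have hνi0 : 0 < ν⁻¹ := _root_.inv_pos.2 hν0
  have hνi1 : ν⁻¹ < 1 := inv_lt_one_of_one_lt₀ hν1
  obtain ⟨R, hR0, hR⟩ : ∃ R, 0 ≤ R ∧ ∀ k, ∀ j < k, (ν⁻¹) ^ j * ‖X k j‖ ^ 2 ≤ R := by
    refine ⟨(C * (1 - ν⁻¹)⁻¹ + ‖T‖ * ‖p‖ ^ 2) / (κ' * ν⁻¹), ?_, fun k j hj => ?_⟩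
    · have : 0 ≤ (1 - ν⁻¹)⁻¹ := _root_.inv_nonneg.2 (by linarith)
      positivity
    have h := backward_energy_single (a := fun i => coneForm T (X k i))
      (d := fun i => ‖X k i‖ ^ 2) (C := C) (κ := κ') hνi0.le hνi1 hκ'.le hC
      (fun i => sq_nonneg _) (k := k) (fun i hi => by
        have h1 := mul_le_mul_of_nonneg_left (hν (X k (i + 1))) hνi0.le
        rw [hXstep k i hi, mul_add, ← mul_assoc, inv_mul_cancel₀ hν0.ne', one_mul] at h1
        linarith) hj
    have h2 := hf.cone.neg_le_coneForm (X k 0)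
    rw [hX0] at h2
    have h3 : coneForm T (X k k) ≤ 0 := by
      rw [hXk]
      have := hf.cone.neg_on _ (hxP k)
      have h4 := mul_nonneg hf.cone.pos.le (sq_nonneg ‖x k‖)
      linarith
    have h4 := mul_nonpos_of_nonneg_of_nonpos (pow_nonneg hνi0.le k) h3
    rw [le_div_iff₀ (by positivity)]
    have e : κ' * (ν⁻¹ ^ (j + 1) * ‖X k j‖ ^ 2) = ν⁻¹ ^ j * ‖X k j‖ ^ 2 * (κ' * ν⁻¹) := by ring
    rw [e] at h
    linarith
  let r : ℝ := μ⁻¹ * ν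
  have hr0 : 0 ≤ r := by positivity
  have hr1 : r < 1 := by
    simp only [r]; rw [inv_mul_lt_iff₀ hμ0]; linarith
  have hdiff : ∀ j k l, j < k → k ≤ l →
      ‖X k j - X l j‖ ^ 2 ≤ (‖T‖ * R / (κ * μ⁻¹ ^ (j + 1))) * r ^ k := by
    intro j k l hjk hkl
    have hμi := hf.inv_pos
    rcases hkl.eq_or_lt with rfl | hkl
    · rw [sub_self, norm_zero, zero_pow two_ne_zero]; positivity
    have h := hf.orbit_energy (X := X k) (Y := X l) (hXstep k)
      (fun i hi => hXstep l i (hi.trans hkl)) hjk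
    -- Both ends of the difference are under control: at 0 the projections agree, so the form is
    -- nonnegative; at k one of the points lies in P, so only the complement part of the other
    -- contributes from above.
    have h1 : 0 ≤ coneForm T (X k 0 - X l 0) :=
      hf.cone.coneForm_nonneg_of_projection_eq_zero (by rw [map_sub, hX0, hX0, sub_self])
    have h2 : coneForm T (X k k - X l k) ≤ ‖T‖ * ‖X l k‖ ^ 2 := by
      refine (hf.cone.coneForm_le_norm_compl _).trans ?_
      have e : X k k - X l k - P.starProjection (X k k - X l k)
          = -(X l k - P.starProjection (X l k)) := by
        rw [map_sub, hXk, Submodule.starProjection_eq_self_iff.2 (hxP k)]; abel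
      rw [e, norm_neg]
      refine mul_le_mul_of_nonneg_left ?_ (norm_nonneg _)
      rw [IsConeOperator.norm_sq_split (P := P) (X l k)]
      have := sq_nonneg ‖P.starProjection (X l k)‖
      linarith
    have h3 : ‖X l k‖ ^ 2 ≤ R * ν ^ k := by
      have := hR l k hkl
      rw [inv_pow, inv_mul_le_iff₀ (by positivity)] at this
      linarith
    have h4 : (μ⁻¹) ^ k * coneForm T (X k k - X l k) ≤ ‖T‖ * R * r ^ k := by
      calc (μ⁻¹) ^ k * coneForm T (X k k - X l k) ≤ (μ⁻¹) ^ k * (‖T‖ * (R * ν ^ k)) := by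
            gcongr
            exact h2.trans (mul_le_mul_of_nonneg_left h3 (norm_nonneg _))
        _ = ‖T‖ * R * r ^ k := by simp only [r, mul_pow]; ring
    rw [div_mul_eq_mul_div, le_div_iff₀ (by positivity)]
    linarith
  have hconv : ∀ j, ∃ y, Tendsto (fun k => X k j) atTop (𝓝 y) := by
    intro j
    have hc : CauchySeq fun k => X (k + (j + 1)) j := by
      refine cauchySeq_of_le_tendsto_0'
        (fun k => Real.sqrt ((‖T‖ * R / (κ * μ⁻¹ ^ (j + 1))) * r ^ (k + (j + 1)))) ?_ ?_
      · intro k l hkl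
        rw [dist_eq_norm]
        exact Real.le_sqrt_of_sq_le (hdiff j _ _ (by omega) (by omega))
      · have h1 : Tendsto (fun k : ℕ => (‖T‖ * R / (κ * μ⁻¹ ^ (j + 1))) * r ^ (k + (j + 1)))
            atTop (𝓝 0) := by
          simpa using ((tendsto_add_atTop_iff_nat (j + 1)).2
            (tendsto_pow_atTop_nhds_zero_of_lt_one hr0 hr1)).const_mul _
        simpa using h1.sqrt
    obtain ⟨y, hy⟩ := cauchySeq_tendsto_of_complete hc
    exact ⟨y, (tendsto_add_atTop_iff_nat (j + 1)).1 hy⟩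
  choose Y hY using hconv
  refine ⟨Y 0, ⟨Y, rfl, fun k => ?_, ?_⟩, ?_⟩
  · refine tendsto_nhds_unique ?_ (hY k)
    refine ((hK.continuous.tendsto _).comp (hY (k + 1))).congr' ?_
    filter_upwards [eventually_gt_atTop k] with i hi using hXstep i k hi
  · have hb : ∀ j, (ν⁻¹) ^ j * ‖Y j‖ ^ 2 ≤ R := fun j =>
      le_of_tendsto (((hY j).norm.pow 2).const_mul _) (by
        filter_upwards [eventually_gt_atTop j] with i hi using hR i j hi)
    refine squeeze_zero (g := fun k => R * r ^ k) (fun k => ?_) (fun k => ?_) ?_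
    · have := hf.inv_pos; positivity
    · have e : (μ⁻¹) ^ k * ‖Y k‖ ^ 2 = r ^ k * ((ν⁻¹) ^ k * ‖Y k‖ ^ 2) := by
        simp only [r, mul_pow, inv_pow]; field_simp
      rw [e, mul_comm R]
      exact mul_le_mul_of_nonneg_left (hb k) (pow_nonneg hr0 k)
    · simpa using (tendsto_pow_atTop_nhds_zero_of_lt_one hr0 hr1).const_mul R
  · refine tendsto_nhds_unique ((P.starProjection.continuous.tendsto _).comp (hY 0)) ?_
    refine tendsto_const_nhds.congr fun k => (hX0 k).symm

theorem exists_lipschitz_graph [CompleteSpace E] [CompleteSpace P] :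
    ∃ (M : P → Pᗮ) (K : NNReal), LipschitzWith K M ∧
      slowSet f μ = Set.range (fun p : P => (p : E) + (M p : E)) := by
  choose x hx hxp using fun p : P => hf.exists_mem_slowSet p.2
  refine ⟨fun p => ⟨x p - p, ?_⟩, (Real.sqrt (1 + ‖T‖ / m) + 1).toNNReal,
    LipschitzWith.of_dist_le_mul fun p p' => ?_, ?_⟩
  · have := Submodule.sub_starProjection_mem_orthogonal (K := P) (x p)
    rwa [hxp] at this
  · rw [dist_eq_norm, dist_eq_norm, Real.coe_toNNReal _ (by positivity)]
    have h := hf.slowSet_norm_le (hx p) (hx p')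
    rw [hxp, hxp] at h
    have e : ((p : E) - p') = ((p - p' : P) : E) := rfl
    rw [e, ← Submodule.coe_norm (p - p')] at h
    change ‖(x p - p) - (x p' - p')‖ ≤ _
    calc ‖(x p - p) - (x p' - p')‖ = ‖(x p - x p') - ((p - p' : P) : E)‖ := by
          congr 1; rw [← e]; abel
      _ ≤ ‖x p - x p'‖ + ‖p - p'‖ := norm_sub_le _ _
      _ ≤ (Real.sqrt (1 + ‖T‖ / m) + 1) * ‖p - p'‖ := by linarith
  · ext y
    simp only [Set.mem_range, add_sub_cancel]
    constructor
    · intro hy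
      refine ⟨⟨P.starProjection y, Submodule.starProjection_apply_mem _ _⟩, ?_⟩
      have h := hf.slowSet_norm_le (hx ⟨P.starProjection y,
        Submodule.starProjection_apply_mem _ _⟩) hy
      rw [hxp, sub_self, norm_zero, mul_zero] at h
      exact sub_eq_zero.1 (norm_le_zero_iff.1 h)
    · rintro ⟨p, rfl⟩
      exact hx p

theorem isClosed_slowSet [CompleteSpace E] [CompleteSpace P] : IsClosed (slowSet f μ) := by
  obtain ⟨M, K, hM, hW⟩ := hf.exists_lipschitz_graph
  have e : slowSet f μ = {x | (M (P.orthogonalProjectionOnto x) : E)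
      = x - P.orthogonalProjectionOnto x} := by
    rw [hW]
    ext x
    constructor
    · rintro ⟨p, rfl⟩
      have h : P.orthogonalProjectionOnto ((p : E) + M p) = p := by
        rw [map_add, Submodule.orthogonalProjectionOnto_mem_subspace_eq_self,
          Submodule.orthogonalProjectionOnto_eq_zero_iff.2 (M p).2, add_zero]
      rw [Set.mem_ofPred_eq, h, add_sub_cancel_left]
    · intro h
      exact ⟨P.orthogonalProjectionOnto x, by
        have h' : (M (P.orthogonalProjectionOnto x) : E)
          = x - P.orthogonalProjectionOnto x := h
        simp only [h', add_sub_cancel]⟩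
  rw [e]
  have := hM.continuous
  exact isClosed_eq (by fun_prop) (by fun_prop)

/-- The slow set is a continuous image of the finite-dimensional space P, and the projection does
not increase norms. -/
theorem isCompact_slowSet_inter_closedBall [CompleteSpace E] [FiniteDimensional ℝ P] (r : ℝ) :
    IsCompact (slowSet f μ ∩ Metric.closedBall 0 r) := by
  obtain ⟨M, K, hM, hW⟩ := hf.exists_lipschitz_graph
  have hc : Continuous (fun p : P => (p : E) + (M p : E)) := by
    have := hM.continuous
    fun_prop
  have : ProperSpace P := FiniteDimensional.proper_real P
  refine ((isCompact_closedBall (0 : P) r).image hc).of_isClosed_subset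
    (hf.isClosed_slowSet.inter Metric.isClosed_closedBall) ?_
  rintro x ⟨hx, hxr⟩
  rw [hW] at hx
  obtain ⟨p, rfl⟩ := hx
  refine ⟨p, ?_, rfl⟩
  rw [mem_closedBall_zero_iff] at hxr ⊢
  refine le_trans ?_ hxr
  have h : P.starProjection ((p : E) + M p) = p := by
    rw [Submodule.starProjection_apply, map_add,
      Submodule.orthogonalProjectionOnto_mem_subspace_eq_self,
      Submodule.orthogonalProjectionOnto_eq_zero_iff.2 (M p).2, add_zero]
  have := P.norm_starProjection_apply_le ((p : E) + M p)
  rwa [h] at this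

omit [InnerProductSpace ℝ E] hf in
theorem exists_backward_mem_slowSet {x : E} (hx : x ∈ slowSet f μ) (k : ℕ) (hμ : 0 < μ) :
    ∃ y ∈ slowSet f μ, f^[k] y = x := by
  obtain ⟨X, rfl, hX, hX0⟩ := hx
  refine ⟨X k, ⟨fun j => X (j + k), by simp, fun j => ?_, ?_⟩, ?_⟩
  · have := hX (j + k)
    rwa [show j + k + 1 = j + 1 + k by omega] at this
  · have h := ((tendsto_add_atTop_iff_nat k).2 hX0).const_mul (μ ^ k)
    rw [mul_zero] at h
    refine h.congr fun j => ?_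
    rw [pow_add, inv_pow, inv_pow]; field_simp
  · induction k with
    | zero => simp
    | succ k ih => rw [Function.iterate_succ_apply, hX]; exact ih

-- A map commuting with f carries backward orbits to backward orbits, and linear growth preserves
-- slowness. Applied to the flow at arbitrary times, it makes a set defined through one time step
-- invariant under the whole semigroup.
omit [InnerProductSpace ℝ E] hf in
theorem map_mem_slowSet {g : E → E} (hμ : 1 < μ) (hg : ∀ x, f (g x) = g (f x)) {C : ℝ}
    (hgC : ∀ x, ‖g x‖ ≤ C * (‖x‖ + 1)) {x : E} (hx : x ∈ slowSet f μ) :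
    g x ∈ slowSet f μ := by
  obtain ⟨X, rfl, hX, hX0⟩ := hx
  refine ⟨fun k => g (X k), rfl, fun k => by rw [hg, hX], ?_⟩
  have hμ0 : 0 < μ⁻¹ := _root_.inv_pos.2 (by linarith)
  have h1 : Tendsto (fun k => 2 * C ^ 2 * ((μ⁻¹) ^ k * ‖X k‖ ^ 2 + (μ⁻¹) ^ k)) atTop (𝓝 0) := by
    simpa using (hX0.add (tendsto_pow_atTop_nhds_zero_of_lt_one hμ0.le
      (inv_lt_one_of_one_lt₀ hμ))).const_mul (2 * C ^ 2)
  refine squeeze_zero (fun k => by positivity) (fun k => ?_) h1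
  have h2 : ‖g (X k)‖ ^ 2 ≤ 2 * C ^ 2 * (‖X k‖ ^ 2 + 1) := by
    calc ‖g (X k)‖ ^ 2 ≤ (C * (‖X k‖ + 1)) ^ 2 := by gcongr; exact hgC _
      _ ≤ 2 * C ^ 2 * (‖X k‖ ^ 2 + 1) := by
        nlinarith [mul_nonneg (sq_nonneg C) (sq_nonneg (‖X k‖ - 1))]
  calc (μ⁻¹) ^ k * ‖g (X k)‖ ^ 2 ≤ (μ⁻¹) ^ k * (2 * C ^ 2 * (‖X k‖ ^ 2 + 1)) := by gcongr
    _ = _ := by ring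

/-- Points of the slow set cannot be far from `x` if they are outside the cone with vertex `x`. -/
theorem exists_norm_le_of_coneForm_nonneg [CompleteSpace E] [CompleteSpace P] :
    ∃ C : ℝ, 0 ≤ C ∧ ∀ x, ∀ w ∈ slowSet f μ, 0 ≤ coneForm T (x - w) →
      ‖x - w‖ ≤ C * (‖x‖ + 1) := by
  obtain ⟨w₀, hw₀, -⟩ := hf.exists_mem_slowSet (P.zero_mem)
  have hc0 : 0 < κ * μ⁻¹ := mul_pos hf.gain_pos hf.inv_pos
  set c := κ * μ⁻¹ with hc
  have hT0 := norm_nonneg T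
  set D := 1 + (3 * ‖T‖ / c + 1) with hD
  have hD0 : 0 ≤ D := by positivity
  refine ⟨D * (‖w₀‖ + 1), by positivity, fun x w hw hxw => ?_⟩
  have h1 := hf.slowSet_strict_cone hw hw₀
  -- Expansion about the fixed slow point w₀. Since V(w - w₀) ≤ -c‖w - w₀‖², nonnegativity of V(x -
  -- w) bounds ‖w - w₀‖ by a multiple of ‖x - w₀‖.
  have h2 := hf.cone.coneForm_add (x - w₀) (-(w - w₀))
  rw [coneForm_neg, show x - w₀ + -(w - w₀) = x - w by abel, inner_neg_right] at h2
  have h3 := (neg_le_abs _).trans (abs_inner_clm_le T (x - w₀) (w - w₀))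
  have h4 := (le_abs_self _).trans (abs_coneForm_le T (x - w₀))
  set a := ‖w - w₀‖
  set b := ‖x - w₀‖
  have ha : 0 ≤ a := norm_nonneg _
  have hb : 0 ≤ b := norm_nonneg _
  have h5 : c * a ^ 2 ≤ 2 * (‖T‖ * b * a) + ‖T‖ * b ^ 2 := by linarith
  have h6 : a ≤ (3 * ‖T‖ / c + 1) * b := by
    by_contra hcon
    push Not at hcon
    have hba : b ≤ a := by
      refine le_trans ?_ hcon.le
      have : 0 ≤ 3 * ‖T‖ / c * b := by positivity
      linarith
    have h7 : c * a ^ 2 ≤ 3 * ‖T‖ * b * a := by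
      have : ‖T‖ * b ^ 2 ≤ ‖T‖ * b * a := by
        rw [sq, ← mul_assoc]; exact mul_le_mul_of_nonneg_left hba (by positivity)
      linarith
    have ha0 : 0 < a := lt_of_le_of_lt (by positivity) hcon
    have h8 : c * a ≤ 3 * ‖T‖ * b := by
      refine le_of_mul_le_mul_right ?_ ha0
      linarith
    have h9 : a ≤ 3 * ‖T‖ / c * b := by
      rw [div_mul_eq_mul_div, le_div_iff₀ hc0]; linarith
    linarith
  have h7 : ‖x - w‖ ≤ b + a := by
    have := norm_sub_le (x - w₀) (w - w₀)
    rwa [sub_sub_sub_cancel_right] at this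
  have h8 : b ≤ ‖x‖ + ‖w₀‖ := norm_sub_le _ _
  have h9 : ‖x‖ + ‖w₀‖ ≤ (‖w₀‖ + 1) * (‖x‖ + 1) := by
    nlinarith [norm_nonneg x, norm_nonneg w₀]
  calc ‖x - w‖ ≤ D * b := by rw [hD]; linarith
    _ ≤ D * ((‖w₀‖ + 1) * (‖x‖ + 1)) := mul_le_mul_of_nonneg_left (h8.trans h9) hD0
    _ = _ := by ring

/-- The sets of slow w with V(f^k x - f^k w) ≥ 0 decrease in k, by the cone condition. Each is
nonempty, because the slow point over P(f^k x) can be pulled back k steps inside the slow set. The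
first is bounded and hence compact, so one w works for all k. -/
theorem exists_tracking [CompleteSpace E] [FiniteDimensional ℝ P] :
    ∃ C : ℝ, 0 ≤ C ∧ ∀ x, ∃ w ∈ slowSet f μ, ∀ k : ℕ,
      μ ^ k * ‖f^[k] x - f^[k] w‖ ^ 2 ≤ C * (‖x‖ + 1) ^ 2 := by
  obtain ⟨D, hD0, hD⟩ := hf.exists_norm_le_of_coneForm_nonneg
  obtain ⟨K, hK⟩ := hf.lipschitz
  have hμ0 : 0 < μ := zero_lt_one.trans hf.one_lt
  have hκ := hf.gain_pos
  have hslow : ∀ k, ∀ w ∈ slowSet f μ, f^[k] w ∈ slowSet f μ := by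
    intro k w hw
    obtain ⟨X, rfl, hX, hX0⟩ := hw
    induction k with
    | zero => exact ⟨X, rfl, hX, hX0⟩
    | succ k ih =>
      rw [Function.iterate_succ_apply']
      refine map_mem_slowSet (C := K + ‖f 0‖) hf.one_lt (fun _ => rfl) (fun x => ?_) ih
      have h1 : ‖f x‖ ≤ ‖f x - f 0‖ + ‖f 0‖ := by simpa using norm_add_le (f x - f 0) (f 0)
      have h2 : ‖f x - f 0‖ ≤ K * ‖x‖ := by simpa using hK.norm_sub_le x 0
      have h3 : (K : ℝ) * ‖x‖ + ‖f 0‖ ≤ (K + ‖f 0‖) * (‖x‖ + 1) := by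
        have : 0 ≤ (K : ℝ) := K.2
        nlinarith [norm_nonneg (f 0), mul_nonneg (norm_nonneg (f 0)) (norm_nonneg x)]
      linarith
  refine ⟨max (D ^ 2) (‖T‖ * D ^ 2 * μ / κ), by positivity, fun x => ?_⟩
  let t : ℕ → Set E := fun k => slowSet f μ ∩ {w | 0 ≤ coneForm T (f^[k] x - f^[k] w)}
  have hcontf : ∀ k, Continuous (f^[k]) := fun k => hK.continuous.iterate k
  have hcl : ∀ k, IsClosed (t k) := fun k => by
    refine hf.isClosed_slowSet.inter (isClosed_le continuous_const ?_)
    have := hcontf k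
    have := continuous_coneForm T
    fun_prop
  obtain ⟨w, hw⟩ : (⋂ k, t k).Nonempty := by
    refine IsCompact.nonempty_iInter_of_sequence_nonempty_isCompact_isClosed t ?_ ?_ ?_ hcl
    · rintro k w ⟨hw, hw2⟩
      refine ⟨hw, ?_⟩
      refine hf.coneForm_nonneg_of_step ?_
      rw [← Function.iterate_succ_apply' f, ← Function.iterate_succ_apply' f]
      exact hw2
    · intro k
      obtain ⟨z, hz, hzp⟩ := hf.exists_mem_slowSet
        (Submodule.starProjection_apply_mem P (f^[k] x))
      obtain ⟨w, hw, rfl⟩ := exists_backward_mem_slowSet hz k hμ0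
      refine ⟨w, hw, hf.cone.coneForm_nonneg_of_projection_eq_zero ?_⟩
      rw [map_sub, hzp, sub_self]
    · refine (hf.isCompact_slowSet_inter_closedBall (‖x‖ + D * (‖x‖ + 1))).of_isClosed_subset
        (hcl 0) ?_
      rintro w ⟨hw, hw2⟩
      refine ⟨hw, ?_⟩
      have h1 := hD x w hw hw2
      rw [mem_closedBall_zero_iff]
      have h2 := norm_sub_le x (x - w)
      rw [sub_sub_cancel] at h2
      linarith
  rw [Set.mem_iInter] at hw
  refine ⟨w, (hw 0).1, fun k => ?_⟩
  have hV : ∀ k, 0 ≤ coneForm T (f^[k] x - f^[k] w) := fun k => (hw k).2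
  have h0 : ‖x - w‖ ≤ D * (‖x‖ + 1) := hD x w (hw 0).1 (hV 0)
  have h0' : ‖x - w‖ ^ 2 ≤ D ^ 2 * (‖x‖ + 1) ^ 2 := by
    rw [← mul_pow]; gcongr
  rcases k with _ | k
  · simp only [pow_zero, Function.iterate_zero, id_eq, one_mul]
    refine h0'.trans (mul_le_mul_of_nonneg_right (le_max_left _ _) (sq_nonneg _))
  have hmain : ∀ k : ℕ, μ ^ k * coneForm T (f^[k] x - f^[k] w) ≤ coneForm T (x - w) := by
    intro k
    induction k with
    | zero => simp
    | succ k ih =>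
      have h1 := mul_le_mul_of_nonneg_left (hf.strong_cone (f^[k] x) (f^[k] w))
        (pow_nonneg hμ0.le k)
      rw [Function.iterate_succ_apply', Function.iterate_succ_apply']
      have h2 : 0 ≤ μ ^ k * (κ * ‖f (f^[k] x) - f (f^[k] w)‖ ^ 2) := by positivity
      rw [mul_add, ← mul_assoc, ← pow_succ] at h1
      linarith
  -- V is indefinite, so its decay alone says nothing about the norm. The gain term of one further
  -- step does, once V ≥ 0 at that step is dropped.
  have h1 := mul_le_mul_of_nonneg_left (hf.strong_cone (f^[k] x) (f^[k] w)) (pow_nonneg hμ0.le k)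
  rw [← Function.iterate_succ_apply' f, ← Function.iterate_succ_apply' f] at h1
  have h2 := mul_nonneg (pow_nonneg hμ0.le k) (mul_nonneg hμ0.le (hV (k + 1)))
  have h3 := (le_abs_self _).trans (abs_coneForm_le T (x - w))
  have h4 := mul_le_mul_of_nonneg_left h0' (norm_nonneg T)
  have h5 : μ ^ k * (κ * ‖f^[k + 1] x - f^[k + 1] w‖ ^ 2) ≤ ‖T‖ * (D ^ 2 * (‖x‖ + 1) ^ 2) := by
    have := hmain k
    rw [mul_add] at h1
    linarith
  have h6 : μ ^ (k + 1) * ‖f^[k + 1] x - f^[k + 1] w‖ ^ 2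
      ≤ ‖T‖ * D ^ 2 * μ / κ * (‖x‖ + 1) ^ 2 := by
    rw [div_mul_eq_mul_div, le_div_iff₀ hκ]
    have := mul_le_mul_of_nonneg_left h5 hμ0.le
    calc _ = μ * (μ ^ k * (κ * ‖f^[k + 1] x - f^[k + 1] w‖ ^ 2)) := by ring
      _ ≤ _ := this
      _ = _ := by ring
  exact h6.trans (mul_le_mul_of_nonneg_right (le_max_right _ _) (sq_nonneg _))

end IsConeMap

end Cone

/-! ### The gap condition and the dissipation inequality in a single mode. -/

section Gap

/-- The dissipation inequality for one mode `λ` of the block operator, with respect to the form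
`p u² + r v²`. -/
def ModeDissipative (lam ρ p r d : ℝ) : Prop :=
  ∀ u v g h : ℝ, 2 * ρ * (p * u ^ 2 + r * v ^ 2) + 2 * p * u * (-lam * (u + v) + g)
    + 2 * r * v * (-lam * v + h) ≤ g ^ 2 + h ^ 2 - d * (u ^ 2 + v ^ 2)

/-- The two quadratic identities are equality in the dissipation condition at the modes adjacent to
the gap. Adding their roots gives √(c² + cb) + √(c² + ca) = b - a, whose solution is c = (2R - a -
b)/3. This equals the given quotient since 4R² - (a + b)² = 3(b - a)². -/
theorem exists_gap_constant {a b L : ℝ} (ha : 0 < a) (hab : a ≤ b) (hL : 0 ≤ L)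
    (hgap : L < (b - a) ^ 2 / (b + a + 2 * Real.sqrt (b ^ 2 - a * b + a ^ 2))) :
    ∃ c θ : ℝ, θ = 2 / 3 * (b + a) - 1 / 3 * Real.sqrt (b ^ 2 - a * b + a ^ 2) ∧
      L < c ∧ 0 < θ ∧ a < θ ∧ θ < b ∧ (b - θ) ^ 2 = c ^ 2 + c * b ∧
      (θ - a) ^ 2 = c ^ 2 + c * a := by
  have hb : 0 < b := ha.trans_le hab
  have hne : a < b := by
    refine lt_of_le_of_ne hab fun h => ?_
    rw [h, sub_self, zero_pow two_ne_zero, zero_div] at hgap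
    linarith
  have hq : 0 ≤ b ^ 2 - a * b + a ^ 2 := by nlinarith [sq_nonneg (b - a)]
  set R := Real.sqrt (b ^ 2 - a * b + a ^ 2)
  have hR0 : 0 ≤ R := Real.sqrt_nonneg _
  have hR2 : R ^ 2 = b ^ 2 - a * b + a ^ 2 := Real.sq_sqrt hq
  have hRb : R < b := abs_lt_of_sq_lt_sq' (by nlinarith) hb.le |>.2
  have hRa : a < R := abs_lt_of_sq_lt_sq' (by nlinarith) hR0 |>.2
  have hc : (b - a) ^ 2 / (b + a + 2 * R) = (2 * R - (a + b)) / 3 := by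
    rw [div_eq_div_iff (by positivity) (by norm_num)]; nlinarith
  rw [hc] at hgap
  refine ⟨_, _, rfl, hgap, by linarith, ?_, by linarith, by nlinarith, by nlinarith⟩
  have : R < 2 * b - a := abs_lt_of_sq_lt_sq' (by nlinarith) (by linarith) |>.2
  linarith

theorem form_nonneg_of_le {D e w v : ℝ} (he : 0 ≤ e) (hD : e ≤ D) :
    0 ≤ D * (w ^ 2 + v ^ 2) + 2 * e * w * v := by
  nlinarith [mul_nonneg he (sq_nonneg (w + v)),
    mul_nonneg (sub_nonneg.2 hD) (add_nonneg (sq_nonneg w) (sq_nonneg v))]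

theorem form_nonneg_of_le' {D e w v : ℝ} (he : 0 ≤ e) (hD : e ≤ D) :
    0 ≤ D * (w ^ 2 + v ^ 2) - 2 * e * w * v := by
  have := form_nonneg_of_le (w := -w) (v := v) he hD
  linarith [neg_sq w]

/-- After squares in g and h are completed, the weights c²/α and α give both diagonal terms the same
coefficient D in the variables cu/α and v, against the cross term 2λc. Thus D ≥ λc suffices. It is
an equality at λ = b, and D - λc increases with λ because 2α > c. -/
theorem modeDissipative_high {lam b θ c : ℝ} (hc : 0 < c) (hθb : θ < b) (hb : 0 < b)
    (hα : (b - θ) ^ 2 = c ^ 2 + c * b) (hlam : b ≤ lam) :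
    ModeDissipative lam θ (c ^ 2 / (b - θ)) (b - θ) (c ^ 2) := by
  intro u v g h
  set α := b - θ with hα_def
  have hα0 : 0 < α := by linarith
  have hcα : c < α := abs_lt_of_sq_lt_sq' (by nlinarith) hα0.le |>.2
  set D := 2 * (lam - θ) * α - α ^ 2 - c ^ 2 with hD
  have hDle : lam * c ≤ D := by
    have : 0 ≤ (lam - b) * (2 * α - c) := mul_nonneg (by linarith) (by linarith)
    nlinarith
  have h1 := form_nonneg_of_le (w := c * u / α) (v := v)
    (mul_nonneg (hb.le.trans hlam) hc.le) hDle
  have h2 : 0 ≤ (g - c ^ 2 / α * u) ^ 2 + (h - α * v) ^ 2 := by positivity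
  have e : g ^ 2 + h ^ 2 - c ^ 2 * (u ^ 2 + v ^ 2)
      - (2 * θ * (c ^ 2 / α * u ^ 2 + α * v ^ 2) + 2 * (c ^ 2 / α) * u * (-lam * (u + v) + g)
        + 2 * α * v * (-lam * v + h))
      = ((g - c ^ 2 / α * u) ^ 2 + (h - α * v) ^ 2)
        + (D * ((c * u / α) ^ 2 + v ^ 2) + 2 * (lam * c) * (c * u / α) * v) := by
    rw [hD]; field_simp; ring
  linarith

/-- Mirror image of the high modes: D = λc at λ = a, and D - λc has slope -(2β + c) in λ. -/
theorem modeDissipative_low {lam a θ c : ℝ} (hc : 0 < c) (hθa : a < θ) (hlam0 : 0 ≤ lam)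
    (hβ : (θ - a) ^ 2 = c ^ 2 + c * a) (hlam : lam ≤ a) :
    ModeDissipative lam θ (-(c ^ 2 / (θ - a))) (-(θ - a)) (c ^ 2) := by
  intro u v g h
  set β := θ - a with hβ_def
  have hβ0 : 0 < β := by linarith
  set D := 2 * (θ - lam) * β - β ^ 2 - c ^ 2 with hD
  have hDle : lam * c ≤ D := by
    have : 0 ≤ (a - lam) * (2 * β + c) := mul_nonneg (by linarith) (by linarith)
    nlinarith
  have h1 := form_nonneg_of_le' (w := c * u / β) (v := v) (mul_nonneg hlam0 hc.le) hDle
  have h2 : 0 ≤ (g + c ^ 2 / β * u) ^ 2 + (h + β * v) ^ 2 := by positivity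
  have e : g ^ 2 + h ^ 2 - c ^ 2 * (u ^ 2 + v ^ 2)
      - (2 * θ * (-(c ^ 2 / β) * u ^ 2 + -β * v ^ 2)
        + 2 * (-(c ^ 2 / β)) * u * (-lam * (u + v) + g) + 2 * (-β) * v * (-lam * v + h))
      = ((g + c ^ 2 / β * u) ^ 2 + (h + β * v) ^ 2)
        + (D * ((c * u / β) ^ 2 + v ^ 2) - 2 * (lam * c) * (c * u / β) * v) := by
    rw [hD]; field_simp; ring
  linarith

/-- The Jordan block remains dissipative for the ordinary norm, as 2u(u + v) + 2v² is a sum of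
squares. This yields the basic energy estimate for well-posedness. -/
theorem modeDissipative_one {lam d : ℝ} (hlam : 0 ≤ lam) :
    ModeDissipative lam (-(1 + d) / 2) 1 1 d := by
  intro u v g h
  have e : g ^ 2 + h ^ 2 - d * (u ^ 2 + v ^ 2)
      - (2 * (-(1 + d) / 2) * (1 * u ^ 2 + 1 * v ^ 2) + 2 * 1 * u * (-lam * (u + v) + g)
        + 2 * 1 * v * (-lam * v + h))
      = (g - u) ^ 2 + (h - v) ^ 2 + lam * (u ^ 2 + v ^ 2 + (u + v) ^ 2) := by ring
  have : 0 ≤ (g - u) ^ 2 + (h - v) ^ 2 + lam * (u ^ 2 + v ^ 2 + (u + v) ^ 2) := by positivity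
  linarith

end Gap

/-! ### Energy estimates in eigencoordinates. -/

section Modal

theorem energy_mode {lam ρ p r d : ℝ} (hdiss : ModeDissipative lam ρ p r d) {u v g h : ℝ → ℝ}
    (hu : Continuous u) (hv : Continuous v) (hg : Continuous g) (hh : Continuous h)
    (hu' : ∀ t, 0 < t → HasDerivAt u (-lam * (u t + v t) + g t) t)
    (hv' : ∀ t, 0 < t → HasDerivAt v (-lam * v t + h t) t) {t : ℝ} (ht : 0 ≤ t) :
    Real.exp (2 * ρ * t) * (p * u t ^ 2 + r * v t ^ 2)
        + d * ∫ s in (0 : ℝ)..t, Real.exp (2 * ρ * s) * (u s ^ 2 + v s ^ 2)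
      ≤ p * u 0 ^ 2 + r * v 0 ^ 2
        + ∫ s in (0 : ℝ)..t, Real.exp (2 * ρ * s) * (g s ^ 2 + h s ^ 2) := by
  let Ψ : ℝ → ℝ := fun s => Real.exp (2 * ρ * s) * (p * u s ^ 2 + r * v s ^ 2)
  let Ψ' : ℝ → ℝ := fun s => Real.exp (2 * ρ * s) *
    (2 * ρ * (p * u s ^ 2 + r * v s ^ 2) + 2 * p * u s * (-lam * (u s + v s) + g s)
      + 2 * r * v s * (-lam * v s + h s))
  have hΨ : ∀ s ∈ Set.Ioo 0 t, HasDerivAt Ψ (Ψ' s) s := by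
    intro s hs
    have h1 : HasDerivAt (fun s => Real.exp (2 * ρ * s)) (Real.exp (2 * ρ * s) * (2 * ρ)) s := by
      simpa using ((hasDerivAt_id s).const_mul (2 * ρ)).exp
    have h2 := (((hu' s hs.1).pow 2).const_mul p).add (((hv' s hs.1).pow 2).const_mul r)
    refine (h1.mul h2).congr_deriv ?_
    simp only [Ψ', Pi.add_apply, Pi.pow_apply]
    push_cast
    ring
  -- Continuity up to 0 with a derivative only on the open interval suffices; nothing is assumed
  -- about the derivative at time 0.
  have hint := intervalIntegral.integral_eq_sub_of_hasDerivAt_of_le ht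
    (by fun_prop : Continuous Ψ).continuousOn hΨ
    ((by fun_prop : Continuous Ψ').intervalIntegrable _ _)
  have hle : ∫ s in (0 : ℝ)..t, Ψ' s ≤ ∫ s in (0 : ℝ)..t,
      (Real.exp (2 * ρ * s) * (g s ^ 2 + h s ^ 2)
        - d * (Real.exp (2 * ρ * s) * (u s ^ 2 + v s ^ 2))) := by
    refine intervalIntegral.integral_mono_on ht
      ((by fun_prop : Continuous Ψ').intervalIntegrable _ _)
      (Continuous.intervalIntegrable (by fun_prop) _ _) fun s _ => ?_
    have := mul_le_mul_of_nonneg_left (hdiss (u s) (v s) (g s) (h s))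
      (Real.exp_pos (2 * ρ * s)).le
    simp only [Ψ']
    linarith
  rw [hint, intervalIntegral.integral_sub (Continuous.intervalIntegrable (by fun_prop) _ _)
    (Continuous.intervalIntegrable (by fun_prop) _ _), intervalIntegral.integral_const_mul] at hle
  simp only [Ψ, mul_zero, Real.exp_zero, one_mul] at hle
  linarith

variable {H : Type*} [NormedAddCommGroup H] [InnerProductSpace ℝ H]
variable {ι : Type*}

/-- `ξ` solves `ξ' + [[1, 1], [0, 1]] A ξ = g` for `t > 0` in the coordinates given by the
eigenbasis `b` of `A`. -/
structure IsModalSolution (b : HilbertBasis ι ℝ H) (lam : ι → ℝ) (ξ g : ℝ → PhaseSpace H) :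
    Prop where
  continuous : Continuous ξ
  continuous_source : Continuous g
  hasDerivAt_fst : ∀ k t, 0 < t → HasDerivAt (fun s => inner ℝ (b k) (ξ s).fst)
    (-lam k * (inner ℝ (b k) (ξ t).fst + inner ℝ (b k) (ξ t).snd) + inner ℝ (b k) (g t).fst) t
  hasDerivAt_snd : ∀ k t, 0 < t → HasDerivAt (fun s => inner ℝ (b k) (ξ s).snd)
    (-lam k * inner ℝ (b k) (ξ t).snd + inner ℝ (b k) (g t).snd) t

theorem HilbertBasis.hasSum_sq_inner (b : HilbertBasis ι ℝ H) (x : H) :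
    HasSum (fun k => inner ℝ (b k) x ^ 2) (‖x‖ ^ 2) := by
  have h := b.hasSum_inner_mul_inner x x
  rw [real_inner_self_eq_norm_sq] at h
  refine h.congr_fun fun k => ?_
  rw [real_inner_comm x, sq]

theorem HilbertBasis.ext_inner (b : HilbertBasis ι ℝ H) {x y : H}
    (h : ∀ k, inner ℝ (b k) x = inner ℝ (b k) y) : x = y := by
  refine b.repr.injective (lp.ext (funext fun k => ?_))
  rw [b.repr_apply_apply, b.repr_apply_apply, h]

theorem hasSum_phase_sq (b : HilbertBasis ι ℝ H) (x : PhaseSpace H) :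
    HasSum (fun k => inner ℝ (b k) x.fst ^ 2 + inner ℝ (b k) x.snd ^ 2) (‖x‖ ^ 2) := by
  rw [WithLp.prod_norm_sq_eq_of_L2]
  exact (b.hasSum_sq_inner _).add (b.hasSum_sq_inner _)

theorem hasSum_integral_phase_sq [Countable ι] (b : HilbertBasis ι ℝ H) {w : ℝ → ℝ}
    (hw : Continuous w) (hw0 : ∀ s, 0 ≤ w s) {x : ℝ → PhaseSpace H} (hx : Continuous x) (t : ℝ) :
    HasSum (fun k => ∫ s in (0 : ℝ)..t,
        w s * (inner ℝ (b k) (x s).fst ^ 2 + inner ℝ (b k) (x s).snd ^ 2))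
      (∫ s in (0 : ℝ)..t, w s * ‖x s‖ ^ 2) := by
  have hs : ∀ s, HasSum (fun k => w s * (inner ℝ (b k) (x s).fst ^ 2
      + inner ℝ (b k) (x s).snd ^ 2)) (w s * ‖x s‖ ^ 2) := fun s =>
    (hasSum_phase_sq b (x s)).mul_left _
  refine intervalIntegral.hasSum_integral_of_dominated_convergence
    (fun k s => w s * (inner ℝ (b k) (x s).fst ^ 2 + inner ℝ (b k) (x s).snd ^ 2))
    (fun k => ?_) (fun k => ?_) ?_ ?_ ?_
  · exact Continuous.aestronglyMeasurable (by fun_prop)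
  · refine Eventually.of_forall fun s _ => ?_
    have := hw0 s
    rw [Real.norm_of_nonneg (by positivity)]
  · exact Eventually.of_forall fun s _ => (hs s).summable
  · refine Continuous.intervalIntegrable ?_ _ _
    simp_rw [fun s => (hs s).tsum_eq]
    fun_prop
  · exact Eventually.of_forall fun s _ => hs s

namespace IsModalSolution

variable {b : HilbertBasis ι ℝ H} {lam : ι → ℝ} {ξ g ξ' g' : ℝ → PhaseSpace H}

theorem sub (h : IsModalSolution b lam ξ g) (h' : IsModalSolution b lam ξ' g') :
    IsModalSolution b lam (fun t => ξ t - ξ' t) (fun t => g t - g' t) where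
  continuous := h.continuous.sub h'.continuous
  continuous_source := h.continuous_source.sub h'.continuous_source
  hasDerivAt_fst k t ht := by
    have := (h.hasDerivAt_fst k t ht).sub (h'.hasDerivAt_fst k t ht)
    simp only [WithLp.sub_fst, WithLp.sub_snd, inner_sub_right]
    exact this.congr_deriv (by ring)
  hasDerivAt_snd k t ht := by
    have := (h.hasDerivAt_snd k t ht).sub (h'.hasDerivAt_snd k t ht)
    simp only [WithLp.sub_snd, inner_sub_right]
    exact this.congr_deriv (by ring)

theorem shift (h : IsModalSolution b lam ξ g) {τ : ℝ} (hτ : 0 ≤ τ) :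
    IsModalSolution b lam (fun t => ξ (t + τ)) (fun t => g (t + τ)) where
  continuous := h.continuous.comp (by fun_prop)
  continuous_source := h.continuous_source.comp (by fun_prop)
  hasDerivAt_fst k t ht := (h.hasDerivAt_fst k (t + τ) (by linarith)).comp_add_const t τ
  hasDerivAt_snd k t ht := (h.hasDerivAt_snd k (t + τ) (by linarith)).comp_add_const t τ

/-- Only the values at nonnegative times matter. -/
theorem congr (h : IsModalSolution b lam ξ g) (hξ' : Continuous ξ') (hg' : Continuous g')
    (hξ : ∀ t, 0 ≤ t → ξ' t = ξ t) (hg : ∀ t, 0 ≤ t → g' t = g t) :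
    IsModalSolution b lam ξ' g' where
  continuous := hξ'
  continuous_source := hg'
  hasDerivAt_fst k t ht := by
    rw [hξ t ht.le, hg t ht.le]
    refine (h.hasDerivAt_fst k t ht).congr_of_eventuallyEq ?_
    filter_upwards [lt_mem_nhds ht] with s hs
    rw [hξ s (le_of_lt hs)]
  hasDerivAt_snd k t ht := by
    rw [hξ t ht.le, hg t ht.le]
    refine (h.hasDerivAt_snd k t ht).congr_of_eventuallyEq ?_
    filter_upwards [lt_mem_nhds ht] with s hs
    rw [hξ s (le_of_lt hs)]

/-- Scalar energy inequalities are summed over the modes, so no differentiability of ξ in the phase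
space is needed. -/
theorem energy [Countable ι] (h : IsModalSolution b lam ξ g) {ρ d : ℝ} {p r : ι → ℝ}
    (hdiss : ∀ k, ModeDissipative (lam k) ρ (p k) (r k) d) {V : PhaseSpace H → ℝ}
    (hV : ∀ x : PhaseSpace H, HasSum (fun k => p k * inner ℝ (b k) x.fst ^ 2
      + r k * inner ℝ (b k) x.snd ^ 2) (V x)) {t : ℝ} (ht : 0 ≤ t) :
    Real.exp (2 * ρ * t) * V (ξ t) + d * ∫ s in (0 : ℝ)..t, Real.exp (2 * ρ * s) * ‖ξ s‖ ^ 2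
      ≤ V (ξ 0) + ∫ s in (0 : ℝ)..t, Real.exp (2 * ρ * s) * ‖g s‖ ^ 2 := by
  have hξ := h.continuous
  have hg := h.continuous_source
  have hw : Continuous fun s => Real.exp (2 * ρ * s) := by fun_prop
  have hw0 : ∀ s, 0 ≤ Real.exp (2 * ρ * s) := fun s => (Real.exp_pos _).le
  refine hasSum_le (fun k => ?_)
    (((hV (ξ t)).mul_left _).add ((hasSum_integral_phase_sq b hw hw0 hξ t).mul_left d))
    ((hV (ξ 0)).add (hasSum_integral_phase_sq b hw hw0 hg t))
  exact energy_mode (hdiss k) (by fun_prop) (by fun_prop) (by fun_prop) (by fun_prop)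
    (h.hasDerivAt_fst k) (h.hasDerivAt_snd k) ht

theorem energy_norm [Countable ι] (h : IsModalSolution b lam ξ g) (hlam : ∀ k, 0 ≤ lam k) (d : ℝ)
    {t : ℝ} (ht : 0 ≤ t) :
    Real.exp (-(1 + d) * t) * ‖ξ t‖ ^ 2
        + d * ∫ s in (0 : ℝ)..t, Real.exp (-(1 + d) * s) * ‖ξ s‖ ^ 2
      ≤ ‖ξ 0‖ ^ 2 + ∫ s in (0 : ℝ)..t, Real.exp (-(1 + d) * s) * ‖g s‖ ^ 2 := by
  have := h.energy (d := d) (fun k => modeDissipative_one (hlam k)) (V := fun x => ‖x‖ ^ 2)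
    (fun x => by simpa using hasSum_phase_sq b x) ht
  rwa [show 2 * (-(1 + d) / 2) = -(1 + d) by ring] at this

/-- Continuous dependence on the initial value if the source is controlled by the solution. -/
theorem norm_sq_le [Countable ι] (h : IsModalSolution b lam ξ g) (hlam : ∀ k, 0 ≤ lam k) {L : ℝ}
    (hg : ∀ t, 0 ≤ t → ‖g t‖ ≤ L * ‖ξ t‖) {t : ℝ} (ht : 0 ≤ t) :
    ‖ξ t‖ ^ 2 ≤ Real.exp ((1 + L ^ 2) * t) * ‖ξ 0‖ ^ 2 := by
  have h1 := h.energy_norm hlam (L ^ 2) ht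
  have hξc := h.continuous
  have hgc := h.continuous_source
  have h2 : ∫ s in (0 : ℝ)..t, Real.exp (-(1 + L ^ 2) * s) * ‖g s‖ ^ 2
      ≤ L ^ 2 * ∫ s in (0 : ℝ)..t, Real.exp (-(1 + L ^ 2) * s) * ‖ξ s‖ ^ 2 := by
    rw [← intervalIntegral.integral_const_mul]
    refine intervalIntegral.integral_mono_on ht (Continuous.intervalIntegrable (by fun_prop) _ _)
      (Continuous.intervalIntegrable (by fun_prop) _ _) fun s hs => ?_
    have h3 : ‖g s‖ ^ 2 ≤ L ^ 2 * ‖ξ s‖ ^ 2 := by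
      rw [← mul_pow]; gcongr; exact hg s hs.1
    have := mul_le_mul_of_nonneg_left h3 (Real.exp_pos (-(1 + L ^ 2) * s)).le
    linarith
  have h3 : Real.exp (-(1 + L ^ 2) * t) * ‖ξ t‖ ^ 2 ≤ ‖ξ 0‖ ^ 2 := by linarith
  have h4 := mul_le_mul_of_nonneg_left h3 (Real.exp_pos ((1 + L ^ 2) * t)).le
  rwa [← mul_assoc, ← Real.exp_add, show (1 + L ^ 2) * t + -(1 + L ^ 2) * t = 0 by ring,
    Real.exp_zero, one_mul] at h4

end IsModalSolution

end Modal

/-! ### Existence and uniqueness for the equation in eigencoordinates. -/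

section Solve

theorem exists_scalar_linear_solution (lam y₀ : ℝ) {h : ℝ → ℝ} (hh : Continuous h) :
    ∃ y : ℝ → ℝ, y 0 = y₀ ∧ ∀ t, HasDerivAt y (-lam * y t + h t) t := by
  refine ⟨fun t => Real.exp (-lam * t) * (y₀ + ∫ s in (0 : ℝ)..t, Real.exp (lam * s) * h s),
    by simp, fun t => ?_⟩
  have hc : Continuous fun s => Real.exp (lam * s) * h s := by fun_prop
  have h1 : HasDerivAt (fun t => Real.exp (-lam * t)) (Real.exp (-lam * t) * -lam) t := by
    simpa using ((hasDerivAt_id t).const_mul (-lam)).exp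
  have h2 := (intervalIntegral.integral_hasDerivAt_right (hc.intervalIntegrable 0 t)
    (hc.stronglyMeasurableAtFilter _ _) hc.continuousAt).const_add y₀
  refine (h1.mul h2).congr_deriv ?_
  have h3 : Real.exp (-lam * t) * (Real.exp (lam * t) * h t) = h t := by
    rw [← mul_assoc, ← Real.exp_add, neg_mul, neg_add_cancel, Real.exp_zero, one_mul]
  rw [h3]
  ring

variable {H : Type*} [NormedAddCommGroup H] [InnerProductSpace ℝ H]
variable {ι : Type*} {b : HilbertBasis ι ℝ H} {lam : ι → ℝ}

/-- Weierstrass M-test for ‖x t - x s‖² = Σ (u_k t - u_k s)², whose terms are at most 4 M_k. -/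
theorem exists_continuous_of_coordinates (b : HilbertBasis ι ℝ H) {u : ι → ℝ → ℝ}
    (hu : ∀ k, Continuous (u k))
    (hM : ∀ T : ℝ, ∃ M : ι → ℝ, Summable M ∧ ∀ k, ∀ t ≤ T, u k t ^ 2 ≤ M k) :
    ∃ x : ℝ → H, Continuous x ∧ ∀ t k, inner ℝ (b k) (x t) = u k t := by
  have hmem : ∀ t, Memℓp (fun k => u k t) 2 := fun t => by
    obtain ⟨M, hMs, hM⟩ := hM t
    refine memℓp_gen ?_
    refine Summable.of_nonneg_of_le (fun k => by positivity) (fun k => ?_) hMs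
    simpa using hM k t le_rfl
  let x : ℝ → H := fun t => b.repr.symm ⟨fun k => u k t, hmem t⟩
  have hx : ∀ t k, inner ℝ (b k) (x t) = u k t := fun t k => by
    rw [← b.repr_apply_apply]
    simp [x]
  refine ⟨x, continuous_iff_continuousAt.2 fun s => ?_, hx⟩
  obtain ⟨M, hMs, hM⟩ := hM (s + 1)
  have hsq : ∀ t, ‖x t - x s‖ ^ 2 = ∑' k, (u k t - u k s) ^ 2 := fun t => by
    rw [← (b.hasSum_sq_inner (x t - x s)).tsum_eq]
    simp only [inner_sub_right, hx]
  have hcont : ContinuousOn (fun t => ∑' k, (u k t - u k s) ^ 2) (Set.Iic (s + 1)) := by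
    refine continuousOn_tsum (u := fun k => 4 * M k) (fun k => ?_) (hMs.mul_left 4) ?_
    · have := hu k
      exact Continuous.continuousOn (by fun_prop)
    · intro k t ht
      rw [Real.norm_of_nonneg (sq_nonneg _)]
      have h1 := hM k t ht
      have h2 := hM k s (by linarith)
      nlinarith [sq_nonneg (u k t + u k s)]
  have hlim := (hcont.continuousAt (Iic_mem_nhds (by linarith))).tendsto
  rw [ContinuousAt, tendsto_iff_norm_sub_tendsto_zero]
  simp only [sub_self, zero_pow two_ne_zero, tsum_zero] at hlim
  have := hlim.sqrt
  simp_rw [← hsq, Real.sqrt_zero, Real.sqrt_sq (norm_nonneg _)] at this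
  exact this

theorem exists_modal_linear_solution [Countable ι] (b : HilbertBasis ι ℝ H)
    (hlam : ∀ k, 0 ≤ lam k) (x₀ : PhaseSpace H) {g : ℝ → PhaseSpace H} (hg : Continuous g) :
    ∃ ξ : ℝ → PhaseSpace H, ξ 0 = x₀ ∧ IsModalSolution b lam ξ g := by
  have hg2 : ∀ k, Continuous fun t => inner ℝ (b k) (g t).snd := fun k => by fun_prop
  have hg1 : ∀ k, Continuous fun t => inner ℝ (b k) (g t).fst := fun k => by fun_prop
  choose v hv0 hv using fun k =>
    exists_scalar_linear_solution (lam k) (inner ℝ (b k) x₀.snd) (hg2 k)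
  have hvc : ∀ k, Continuous (v k) := fun k =>
    continuous_iff_continuousAt.2 fun t => (hv k t).continuousAt
  -- The system is triangular: v is already known, and -λv enters the equation for u as a source.
  choose u hu0 hu using fun k => exists_scalar_linear_solution (lam k) (inner ℝ (b k) x₀.fst)
    ((hg1 k).sub ((hvc k).const_mul (lam k)))
  have huc : ∀ k, Continuous (u k) := fun k =>
    continuous_iff_continuousAt.2 fun t => (hu k t).continuousAt
  have hu' : ∀ k t, HasDerivAt (u k) (-lam k * (u k t + v k t) + inner ℝ (b k) (g t).fst) t :=
    fun k t => (hu k t).congr_deriv (by rw [Pi.sub_apply]; ring)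
  have hbound : ∀ T : ℝ, ∃ M : ι → ℝ, Summable M ∧ ∀ k, ∀ t ≤ T,
      u k (max t 0) ^ 2 + v k (max t 0) ^ 2 ≤ M k := by
    intro T
    set T' := max T 0
    have hw : Continuous fun s => Real.exp (2 * (-(1 + 0) / 2) * s) := by fun_prop
    have hw0 : ∀ s, 0 ≤ Real.exp (2 * (-(1 + 0) / 2) * s) := fun s => (Real.exp_pos _).le
    -- The majorant is the right side of the energy inequality with d = 0, integrated up to T' and
    -- multiplied by e^{T'}; it is summable over the modes.
    refine ⟨_, (((hasSum_phase_sq b x₀).add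
      (hasSum_integral_phase_sq b hw hw0 hg T')).mul_left (Real.exp T')).summable, ?_⟩
    intro k t htT
    set τ := max t 0
    have hτ0 : 0 ≤ τ := le_max_right _ _
    have hτT : τ ≤ T' := max_le_max_right _ htT
    have h := energy_mode (modeDissipative_one (d := 0) (hlam k)) (huc k) (hvc k) (hg1 k) (hg2 k)
      (fun t _ => hu' k t) (fun t _ => hv k t) hτ0
    rw [hu0, hv0, zero_mul, add_zero, one_mul, one_mul, one_mul, one_mul] at h
    have hmono : ∫ s in (0 : ℝ)..τ, Real.exp (2 * (-(1 + 0) / 2) * s) *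
          (inner ℝ (b k) (g s).fst ^ 2 + inner ℝ (b k) (g s).snd ^ 2)
        ≤ ∫ s in (0 : ℝ)..T', Real.exp (2 * (-(1 + 0) / 2) * s) *
          (inner ℝ (b k) (g s).fst ^ 2 + inner ℝ (b k) (g s).snd ^ 2) := by
      refine intervalIntegral.integral_mono_interval le_rfl hτ0 hτT
        (Eventually.of_forall fun s => ?_) (Continuous.intervalIntegrable (by fun_prop) _ _)
      exact mul_nonneg (hw0 s) (by positivity)
    have h1 := mul_le_mul_of_nonneg_left (h.trans (add_le_add_right hmono _))
      (Real.exp_pos τ).le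
    rw [← mul_assoc, ← Real.exp_add, show τ + 2 * (-(1 + 0) / 2) * τ = 0 by ring, Real.exp_zero,
      one_mul] at h1
    refine h1.trans (mul_le_mul_of_nonneg_right (Real.exp_le_exp.2 hτT) ?_)
    refine add_nonneg (by positivity) (intervalIntegral.integral_nonneg (hτ0.trans hτT) ?_)
    exact fun s _ => mul_nonneg (hw0 s) (by positivity)
  obtain ⟨x, hxc, hx⟩ := exists_continuous_of_coordinates b (u := fun k t => u k (max t 0))
    (fun k => (huc k).comp (by fun_prop)) fun T => by
      obtain ⟨M, hMs, hM⟩ := hbound T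
      exact ⟨M, hMs, fun k t ht => le_trans (by nlinarith [sq_nonneg (v k (max t 0))]) (hM k t ht)⟩
  obtain ⟨y, hyc, hy⟩ := exists_continuous_of_coordinates b (u := fun k t => v k (max t 0))
    (fun k => (hvc k).comp (by fun_prop)) fun T => by
      obtain ⟨M, hMs, hM⟩ := hbound T
      exact ⟨M, hMs, fun k t ht => le_trans (by nlinarith [sq_nonneg (u k (max t 0))]) (hM k t ht)⟩
  refine ⟨fun t => WithLp.toLp 2 (x t, y t), ?_, by fun_prop, hg, fun k t ht => ?_,
    fun k t ht => ?_⟩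
  · have h1 : x 0 = x₀.fst := b.ext_inner fun k => by rw [hx, max_self, hu0]
    have h2 : y 0 = x₀.snd := b.ext_inner fun k => by rw [hy, max_self, hv0]
    change WithLp.toLp 2 (x 0, y 0) = x₀
    rw [h1, h2]
    rfl
  · simp only [WithLp.toLp_fst, WithLp.toLp_snd, hx, hy, max_eq_left ht.le]
    refine (hu' k t).congr_of_eventuallyEq ?_
    filter_upwards [lt_mem_nhds ht] with s hs
    rw [max_eq_left (le_of_lt hs)]
  · simp only [WithLp.toLp_snd, hy, max_eq_left ht.le]
    refine (hv k t).congr_of_eventuallyEq ?_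
    filter_upwards [lt_mem_nhds ht] with s hs
    rw [max_eq_left (le_of_lt hs)]

/-- The linear problem preserves growth e^{ρt} once 2ρ > 1, with a gain 1/(2ρ - 1) that is small for
large ρ: the contraction estimate for Picard iteration in a weighted norm. -/
theorem IsModalSolution.norm_le_of_source_exp [Countable ι] {ξ g : ℝ → PhaseSpace H}
    (h : IsModalSolution b lam ξ g) (hlam : ∀ k, 0 ≤ lam k) {ρ G : ℝ} (hρ : 1 < 2 * ρ)
    (hG : ∀ s, 0 ≤ s → ‖g s‖ ≤ Real.exp (ρ * s) * G) {t : ℝ} (ht : 0 ≤ t) :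
    (Real.exp (-(ρ * t)) * ‖ξ t‖) ^ 2 ≤ ‖ξ 0‖ ^ 2 + G ^ 2 / (2 * ρ - 1) := by
  have h1 := h.energy_norm hlam 0 ht
  have hgc := h.continuous_source
  have hc : (0 : ℝ) < 2 * ρ - 1 := by linarith
  have h2 : ∫ s in (0 : ℝ)..t, Real.exp (-(1 + 0) * s) * ‖g s‖ ^ 2
      ≤ ∫ s in (0 : ℝ)..t, Real.exp ((2 * ρ - 1) * s) * G ^ 2 := by
    refine intervalIntegral.integral_mono_on ht (Continuous.intervalIntegrable (by fun_prop) _ _)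
      (Continuous.intervalIntegrable (by fun_prop) _ _) fun s hs => ?_
    calc Real.exp (-(1 + 0) * s) * ‖g s‖ ^ 2
        ≤ Real.exp (-(1 + 0) * s) * (Real.exp (ρ * s) * G) ^ 2 := by
          gcongr; exact hG s hs.1
      _ = (Real.exp (-(1 + 0) * s) * Real.exp (ρ * s) * Real.exp (ρ * s)) * G ^ 2 := by ring
      _ = Real.exp ((2 * ρ - 1) * s) * G ^ 2 := by
          rw [← Real.exp_add, ← Real.exp_add]; congr 2; ring
  have h3 : ∫ s in (0 : ℝ)..t, Real.exp ((2 * ρ - 1) * s) * G ^ 2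
      = (Real.exp ((2 * ρ - 1) * t) - 1) * (G ^ 2 / (2 * ρ - 1)) := by
    have hd : ∀ s ∈ Set.uIcc 0 t, HasDerivAt
        (fun s => Real.exp ((2 * ρ - 1) * s) * (G ^ 2 / (2 * ρ - 1)))
        (Real.exp ((2 * ρ - 1) * s) * G ^ 2) s := fun s _ => by
      have := (((hasDerivAt_id s).const_mul (2 * ρ - 1)).exp).mul_const (G ^ 2 / (2 * ρ - 1))
      refine this.congr_deriv ?_
      simp only [id_eq]
      field_simp
    rw [intervalIntegral.integral_eq_sub_of_hasDerivAt hd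
      (Continuous.intervalIntegrable (by fun_prop) _ _)]
    simp only [mul_zero, Real.exp_zero]
    ring
  rw [h3] at h2
  have h4 : Real.exp (-(1 + 0) * t) * ‖ξ t‖ ^ 2
      ≤ ‖ξ 0‖ ^ 2 + (Real.exp ((2 * ρ - 1) * t) - 1) * (G ^ 2 / (2 * ρ - 1)) := by
    rw [zero_mul, add_zero] at h1
    exact h1.trans (add_le_add_right h2 _)
  have hD : 0 ≤ G ^ 2 / (2 * ρ - 1) := by positivity
  set D := G ^ 2 / (2 * ρ - 1)
  have h5 := mul_le_mul_of_nonneg_left h4 (Real.exp_pos (-((2 * ρ - 1) * t))).le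
  have e1 : Real.exp (-((2 * ρ - 1) * t)) * (Real.exp (-(1 + 0) * t) * ‖ξ t‖ ^ 2)
      = (Real.exp (-(ρ * t)) * ‖ξ t‖) ^ 2 := by
    rw [mul_pow, ← mul_assoc, ← Real.exp_add, ← Real.exp_nat_mul]
    congr 2; push_cast; ring
  have e2 : Real.exp (-((2 * ρ - 1) * t)) * (‖ξ 0‖ ^ 2 + (Real.exp ((2 * ρ - 1) * t) - 1) * D)
      = Real.exp (-((2 * ρ - 1) * t)) * ‖ξ 0‖ ^ 2 + D
        - Real.exp (-((2 * ρ - 1) * t)) * D := by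
    have : Real.exp (-((2 * ρ - 1) * t)) * Real.exp ((2 * ρ - 1) * t) = 1 := by
      rw [← Real.exp_add, neg_add_cancel, Real.exp_zero]
    linear_combination D * this
  rw [e1, e2] at h5
  have h6 : Real.exp (-((2 * ρ - 1) * t)) ≤ 1 := Real.exp_le_one_iff.2 (by nlinarith)
  have h7 := mul_le_mul_of_nonneg_right h6 (sq_nonneg ‖ξ 0‖)
  have h8 := mul_nonneg (Real.exp_pos (-((2 * ρ - 1) * t))).le hD
  linarith

theorem exists_modal_solution [Countable ι] [CompleteSpace H] (b : HilbertBasis ι ℝ H)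
    (hlam : ∀ k, 0 ≤ lam k) {F : PhaseSpace H → PhaseSpace H} {L : NNReal}
    (hF : LipschitzWith L F) (x₀ : PhaseSpace H) :
    ∃ ξ : ℝ → PhaseSpace H, ξ 0 = x₀ ∧ IsModalSolution b lam ξ (fun t => F (ξ t)) := by
  have hFc := hF.continuous
  choose sol hsol0 hsol using fun g : {g : ℝ → PhaseSpace H // Continuous g} =>
    exists_modal_linear_solution b hlam x₀ g.2
  -- Then 2ρ - 1 = 4L² + 1, and L²/(4L² + 1) ≤ 1/4 gives contraction factor 1/2. The unknown is y =
  -- e^{-ρt} ξ, frozen at negative times so that it is bounded on all of ℝ.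
  set ρ : ℝ := 2 * (L : ℝ) ^ 2 + 1 with hρdef
  have hL0 : (0 : ℝ) ≤ L := L.2
  have hρ : 1 < 2 * ρ := by nlinarith [sq_nonneg (L : ℝ)]
  let lift : BoundedContinuousFunction ℝ (PhaseSpace H) → ℝ → PhaseSpace H :=
    fun y t => Real.exp (ρ * max t 0) • y t
  have hlift : ∀ y, Continuous (lift y) := fun y => by
    have := y.continuous
    fun_prop
  let src : BoundedContinuousFunction ℝ (PhaseSpace H) → {g : ℝ → PhaseSpace H // Continuous g} :=
    fun y => ⟨fun t => F (lift y t), hFc.comp (hlift y)⟩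
  have hnorm : ∀ (y : ℝ → PhaseSpace H) (t : ℝ), ‖Real.exp (-(ρ * max t 0)) • y (max t 0)‖
      = Real.exp (-(ρ * max t 0)) * ‖y (max t 0)‖ := fun y t => by
    rw [norm_smul, Real.norm_of_nonneg (Real.exp_pos _).le]
  have hsrc : ∀ y s, 0 ≤ s → ‖(src y).1 s‖ ≤ Real.exp (ρ * s) * (L * ‖y‖ + ‖F 0‖) := by
    intro y s hs
    have h1 : ‖F (lift y s)‖ ≤ ‖F (lift y s) - F 0‖ + ‖F 0‖ := by
      simpa using norm_add_le (F (lift y s) - F 0) (F 0)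
    have h2 : ‖F (lift y s) - F 0‖ ≤ L * ‖lift y s‖ := by
      simpa using hF.norm_sub_le (lift y s) 0
    have h3 : ‖lift y s‖ ≤ Real.exp (ρ * s) * ‖y‖ := by
      simp only [lift, max_eq_left hs, norm_smul, Real.norm_of_nonneg (Real.exp_pos _).le]
      gcongr
      exact y.norm_coe_le_norm s
    have h4 : 1 ≤ Real.exp (ρ * s) := Real.one_le_exp (by positivity)
    have h5 := mul_le_mul_of_nonneg_left h3 hL0
    have h6 := mul_le_mul_of_nonneg_right h4 (norm_nonneg (F 0))
    change ‖F (lift y s)‖ ≤ _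
    linarith
  let Φ : BoundedContinuousFunction ℝ (PhaseSpace H) → BoundedContinuousFunction ℝ (PhaseSpace H) :=
    fun y => BoundedContinuousFunction.ofNormedAddCommGroup
      (fun t => Real.exp (-(ρ * max t 0)) • sol (src y) (max t 0))
      (by have := (hsol (src y)).continuous
          fun_prop)
      (Real.sqrt (‖x₀‖ ^ 2 + (L * ‖y‖ + ‖F 0‖) ^ 2 / (2 * ρ - 1))) (fun t => by
        rw [hnorm]
        refine Real.le_sqrt_of_sq_le ?_
        have := (hsol (src y)).norm_le_of_source_exp hlam hρ (hsrc y) (le_max_right t 0)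
        rwa [hsol0] at this)
  have hcontr : ContractingWith (1 / 2) Φ := by
    refine ⟨by rw [← NNReal.coe_lt_coe]; norm_num, LipschitzWith.of_dist_le_mul fun y z => ?_⟩
    rw [BoundedContinuousFunction.dist_le (by positivity)]
    intro t
    have hsub := (hsol (src y)).sub (hsol (src z))
    have h1 := hsub.norm_le_of_source_exp hlam hρ (G := L * dist y z) (fun s hs => ?_)
      (le_max_right t 0)
    · rw [hsol0, hsol0, sub_self, norm_zero, zero_pow two_ne_zero, zero_add] at h1
      have e : dist (Φ y t) (Φ z t) = Real.exp (-(ρ * max t 0)) *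
          ‖sol (src y) (max t 0) - sol (src z) (max t 0)‖ := by
        rw [dist_eq_norm]
        simp only [Φ, BoundedContinuousFunction.coe_ofNormedAddCommGroup]
        rw [← smul_sub, norm_smul, Real.norm_of_nonneg (Real.exp_pos _).le]
      rw [e]
      refine abs_le_of_sq_le_sq' (h1.trans ?_) (by positivity) |>.2
      rw [div_le_iff₀ (by linarith), hρdef]
      push_cast
      nlinarith [sq_nonneg (dist y z), mul_nonneg (sq_nonneg (L : ℝ)) (sq_nonneg (dist y z))]
    · change ‖F (lift y s) - F (lift z s)‖ ≤ _
      refine (hF.norm_sub_le _ _).trans ?_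
      have : ‖lift y s - lift z s‖ ≤ Real.exp (ρ * s) * dist y z := by
        simp only [lift, max_eq_left hs]
        rw [← smul_sub, norm_smul, Real.norm_of_nonneg (Real.exp_pos _).le, ← dist_eq_norm]
        gcongr
        exact BoundedContinuousFunction.dist_coe_le_dist s
      have := mul_le_mul_of_nonneg_left this hL0
      linarith
  have hfix := hcontr.fixedPoint_isFixedPt.eq
  set y := ContractingWith.fixedPoint Φ hcontr
  refine ⟨sol (src y), hsol0 _, (hsol (src y)).congr (hsol (src y)).continuous
    (hFc.comp (hsol (src y)).continuous) (fun _ _ => rfl) fun t ht => ?_⟩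
  have h1 : Real.exp (-(ρ * max t 0)) • sol (src y) (max t 0) = y t :=
    congrArg (fun z : BoundedContinuousFunction ℝ (PhaseSpace H) => z t) hfix
  change F (sol (src y) t) = F (lift y t)
  simp only [lift]
  rw [← h1, smul_smul, ← Real.exp_add, add_neg_cancel, Real.exp_zero, one_smul, max_eq_left ht]

/-- Continuous dependence for two solutions of the semilinear equation. -/
theorem IsModalSolution.norm_sub_sq_le [Countable ι] (hlam : ∀ k, 0 ≤ lam k)
    {F : PhaseSpace H → PhaseSpace H} {L : NNReal} (hF : LipschitzWith L F)
    {ξ η : ℝ → PhaseSpace H} (hξ : IsModalSolution b lam ξ (fun t => F (ξ t)))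
    (hη : IsModalSolution b lam η (fun t => F (η t))) {t : ℝ} (ht : 0 ≤ t) :
    ‖ξ t - η t‖ ^ 2 ≤ Real.exp ((1 + (L : ℝ) ^ 2) * t) * ‖ξ 0 - η 0‖ ^ 2 :=
  (hξ.sub hη).norm_sq_le hlam (fun _ _ => hF.norm_sub_le _ _) ht

theorem IsModalSolution.eq_of_initial [Countable ι] (hlam : ∀ k, 0 ≤ lam k)
    {F : PhaseSpace H → PhaseSpace H} {L : NNReal} (hF : LipschitzWith L F)
    {ξ η : ℝ → PhaseSpace H} (hξ : IsModalSolution b lam ξ (fun t => F (ξ t)))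
    (hη : IsModalSolution b lam η (fun t => F (η t))) (h0 : ξ 0 = η 0) {t : ℝ} (ht : 0 ≤ t) :
    ξ t = η t := by
  have h := hξ.norm_sub_sq_le hlam hF hη ht
  rw [h0, sub_self, norm_zero, zero_pow two_ne_zero, mul_zero] at h
  exact sub_eq_zero.1 (norm_eq_zero.1 (pow_eq_zero_iff two_ne_zero |>.1
    (le_antisymm h (sq_nonneg _))))

end Solve

/-! ### Diagonalisation of the operator; mild solutions and coordinate equations. -/

section Spectral

variable {H : Type*} [NormedAddCommGroup H] [InnerProductSpace ℝ H]

/-- In the coordinates of the Hilbert basis `b`, the operator `A` is multiplication by `lam` on its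
maximal domain. -/
structure IsDiagonalIn {ι : Type*} (A : H →ₗ.[ℝ] H) (b : HilbertBasis ι ℝ H) (lam : ι → ℝ) :
    Prop where
  coord : ∀ (x : A.domain) (k : ι), inner ℝ (b k) (A x) = lam k * inner ℝ (b k) (x : H)
  maximal : ∀ x y : H, (∀ k, inner ℝ (b k) y = lam k * inner ℝ (b k) x) →
    ∃ h : x ∈ A.domain, A ⟨x, h⟩ = y

theorem mem_prodSelf {V : Submodule ℝ H} {x : PhaseSpace H} :
    x ∈ prodSelf V ↔ x.fst ∈ V ∧ x.snd ∈ V := Iff.rfl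

theorem LinearPMap.inner_apply_eq_of_isSelfAdjoint [CompleteSpace H] {A : H →ₗ.[ℝ] H}
    (hsa : IsSelfAdjoint A) (x y : A.domain) : inner ℝ (A x) (y : H) = inner ℝ (x : H) (A y) := by
  have h := LinearPMap.adjoint_isFormalAdjoint hsa.dense_domain
  rw [LinearPMap.isSelfAdjoint_def.1 hsa] at h
  exact h x y

theorem IsEigenEnumeration.pos {A : H →ₗ.[ℝ] H} {lam : ℕ+ → ℝ} {e : ℕ+ → H}
    (henum : IsEigenEnumeration A lam e)
    (hpos : ∀ x : A.domain, x ≠ 0 → 0 < inner ℝ (A x) (x : H)) (k : ℕ+) : 0 < lam k := by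
  have hne : (⟨e k, henum.mem_domain k⟩ : A.domain) ≠ 0 := fun h =>
    henum.orthonormal.ne_zero k (congrArg Subtype.val h)
  have := hpos _ hne
  rw [henum.eigen, real_inner_smul_left, real_inner_self_eq_norm_sq, henum.orthonormal.1 k] at this
  simpa using this

/-- The inverse is compact and symmetric, so its eigenvectors span a dense subspace. They are
eigenvectors of `A` and thus already in the list. Maximality holds because an x with λ_k x_k = y_k
has the coordinates of `T y`, which lies in the domain. -/
theorem IsEigenEnumeration.exists_hilbertBasis [CompleteSpace H] {A : H →ₗ.[ℝ] H}
    (hsa : IsSelfAdjoint A) (hcomp : HasCompactInverse A) {lam : ℕ+ → ℝ} {e : ℕ+ → H}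
    (henum : IsEigenEnumeration A lam e) (hlam : ∀ k, 0 < lam k) :
    ∃ b : HilbertBasis ℕ+ ℝ H, (∀ k, b k = e k) ∧ IsDiagonalIn A b lam := by
  obtain ⟨T, hT, hAT, hTA⟩ := hcomp
  choose hTmem hAT using hAT
  have hsymm := LinearPMap.inner_apply_eq_of_isSelfAdjoint hsa
  have hTsymm : ∀ x y, inner ℝ (T x) y = inner ℝ x (T y) := fun x y => by
    have := hsymm ⟨T x, hTmem x⟩ ⟨T y, hTmem y⟩
    rw [hAT, hAT] at this
    exact this.symm
  have hbot : (Submodule.span ℝ (Set.range e))ᗮ = ⊥ := by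
    rw [eq_bot_iff, ← ContinuousLinearMap.orthogonalComplement_iSup_eigenspaces_eq_bot hT
      (fun x y => hTsymm x y)]
    refine Submodule.orthogonal_le (iSup_le fun μ y hy => ?_)
    have hy : T y = μ • y := Module.End.mem_eigenspace_iff.1 hy
    have hAy := hAT y
    -- The inverse has trivial kernel, so the eigenvalue 0 contributes only y = 0.
    rcases eq_or_ne μ 0 with rfl | hμ
    · have h0 : (⟨T y, hTmem y⟩ : A.domain) = 0 := Subtype.ext (by simpa using hy)
      rw [h0, A.map_zero] at hAy
      rw [← hAy]
      exact Submodule.zero_mem _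
    · have hyT : y = μ⁻¹ • T y := by rw [hy, smul_smul, inv_mul_cancel₀ hμ, one_smul]
      have hmem : y ∈ A.domain := by
        rw [hyT]; exact A.domain.smul_mem _ (hTmem y)
      have hA : A ⟨y, hmem⟩ = μ⁻¹ • y := by
        have : (⟨y, hmem⟩ : A.domain) = μ⁻¹ • ⟨T y, hTmem y⟩ := Subtype.ext hyT
        rw [this, A.map_smul, hAy]
      exact Submodule.span_mono (Set.image_subset_range _ _) (henum.exhaustive _ _ hA)
  have hb : ∀ k, HilbertBasis.mkOfOrthogonalEqBot henum.orthonormal hbot k = e k := fun k => by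
    rw [HilbertBasis.coe_mkOfOrthogonalEqBot]
  refine ⟨HilbertBasis.mkOfOrthogonalEqBot henum.orthonormal hbot, hb, ?_, ?_⟩
  · intro x k
    rw [hb, ← hsymm ⟨e k, henum.mem_domain k⟩ x, henum.eigen, real_inner_smul_left]
  · intro x y hxy
    have hTe : ∀ k, T (e k) = (lam k)⁻¹ • e k := fun k => by
      have := hTA ⟨e k, henum.mem_domain k⟩
      rw [henum.eigen, map_smul] at this
      change lam k • T (e k) = e k at this
      nth_rewrite 2 [← this]
      rw [smul_smul, inv_mul_cancel₀ (hlam k).ne', one_smul]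
    have hx : x = T y := by
      refine (HilbertBasis.mkOfOrthogonalEqBot henum.orthonormal hbot).ext_inner fun k => ?_
      have h1 := hxy k
      rw [hb] at h1 ⊢
      rw [← hTsymm, hTe, real_inner_smul_left, h1, ← mul_assoc, inv_mul_cancel₀ (hlam k).ne',
        one_mul]
    subst hx
    exact ⟨hTmem y, hAT y⟩

variable {ι : Type*} {A : H →ₗ.[ℝ] H} {b : HilbertBasis ι ℝ H} {lam : ι → ℝ}

/-- The coordinate functionals of the first component. -/
noncomputable def fstCoord (b : HilbertBasis ι ℝ H) (k : ι) : PhaseSpace H →L[ℝ] ℝ :=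
  (innerSL ℝ (b k)).comp (WithLp.fstL 2 ℝ H H)

/-- The coordinate functionals of the second component. -/
noncomputable def sndCoord (b : HilbertBasis ι ℝ H) (k : ι) : PhaseSpace H →L[ℝ] ℝ :=
  (innerSL ℝ (b k)).comp (WithLp.sndL 2 ℝ H H)

theorem fstCoord_apply (b : HilbertBasis ι ℝ H) (k : ι) (x : PhaseSpace H) :
    fstCoord b k x = inner ℝ (b k) x.fst := rfl

theorem sndCoord_apply (b : HilbertBasis ι ℝ H) (k : ι) (x : PhaseSpace H) :
    sndCoord b k x = inner ℝ (b k) x.snd := rfl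

theorem IsDiagonalIn.fstCoord_jordanOperator (hA : IsDiagonalIn A b lam)
    (x : (jordanOperator A).domain) (k : ι) :
    fstCoord b k (jordanOperator A x)
      = lam k * (fstCoord b k (x : PhaseSpace H) + sndCoord b k (x : PhaseSpace H)) := by
  have h : fstCoord b k (jordanOperator A x) = inner ℝ (b k)
    (A ⟨(x : PhaseSpace H).fst, x.2.1⟩ + A ⟨(x : PhaseSpace H).snd, x.2.2⟩) := rfl
  rw [h, inner_add_right, hA.coord, hA.coord, ← mul_add]
  rfl

theorem IsDiagonalIn.sndCoord_jordanOperator (hA : IsDiagonalIn A b lam)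
    (x : (jordanOperator A).domain) (k : ι) :
    sndCoord b k (jordanOperator A x) = lam k * sndCoord b k (x : PhaseSpace H) := by
  have h : sndCoord b k (jordanOperator A x)
    = inner ℝ (b k) (A ⟨(x : PhaseSpace H).snd, x.2.2⟩) := rfl
  rw [h, hA.coord]
  rfl

theorem exists_jordanOperator_eq {x : PhaseSpace H} (h₁ : x.fst ∈ A.domain)
    (h₂ : x.snd ∈ A.domain) : ∃ h : x ∈ (jordanOperator A).domain,
      jordanOperator A ⟨x, h⟩ = WithLp.toLp 2 (A ⟨x.fst, h₁⟩ + A ⟨x.snd, h₂⟩, A ⟨x.snd, h₂⟩) :=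
  ⟨⟨h₁, h₂⟩, rfl⟩

theorem ContinuousLinearMap.apply_intervalIntegral [CompleteSpace H]
    (φ : PhaseSpace H →L[ℝ] ℝ) {ξ : ℝ → PhaseSpace H} (hξ : Continuous ξ) (t : ℝ) :
    φ (∫ s in (0 : ℝ)..t, ξ s) = ∫ s in (0 : ℝ)..t, φ (ξ s) :=
  (φ.intervalIntegral_comp_comm (hξ.intervalIntegrable _ _)).symm

theorem hasDerivAt_of_eq_integral {u f : ℝ → ℝ} (hf : Continuous f) {a : ℝ}
    (h : ∀ t, 0 ≤ t → u t = a + ∫ s in (0 : ℝ)..t, f s) {t : ℝ} (ht : 0 < t) :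
    HasDerivAt u (f t) t := by
  refine ((intervalIntegral.integral_hasDerivAt_right (hf.intervalIntegrable 0 t)
    (hf.stronglyMeasurableAtFilter _ _) hf.continuousAt).const_add a).congr_of_eventuallyEq ?_
  filter_upwards [lt_mem_nhds ht] with s hs using h s (le_of_lt hs)

theorem eq_integral_of_hasDerivAt {u f : ℝ → ℝ} (hu : Continuous u) (hf : Continuous f)
    (h : ∀ t, 0 < t → HasDerivAt u (f t) t) {t : ℝ} (ht : 0 ≤ t) :
    u t - u 0 = ∫ s in (0 : ℝ)..t, f s :=
  (intervalIntegral.integral_eq_sub_of_hasDerivAt_of_le ht hu.continuousOn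
    (fun s hs => h s hs.1) (hf.intervalIntegrable _ _)).symm

/-- Each coordinate of the mild equation is a scalar integral equation with continuous integrand,
hence differentiable for t > 0. The curves ζ and g are continuous extensions to negative times,
where ξ is arbitrary. -/
theorem IsMildSolution.isModalSolution [CompleteSpace H] (hA : IsDiagonalIn A b lam)
    {F : PhaseSpace H → PhaseSpace H} {ξ ζ g : ℝ → PhaseSpace H}
    (h : IsMildSolution (jordanOperator A) F ξ) (hc : Continuous ζ) (hgc : Continuous g)
    (hζ : ∀ t, 0 ≤ t → ζ t = ξ t) (hg : ∀ t, 0 ≤ t → g t = F (ξ t)) :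
    IsModalSolution b lam ζ g := by
  have hint : ∀ {t : ℝ}, 0 ≤ t → ∫ s in (0 : ℝ)..t, ξ s = ∫ s in (0 : ℝ)..t, ζ s :=
    fun ht => intervalIntegral.integral_congr fun s hs => by
      rw [Set.uIcc_of_le ht] at hs
      exact (hζ s hs.1).symm
  have hgint : ∀ {t : ℝ}, 0 ≤ t → ∫ s in (0 : ℝ)..t, F (ξ s) = ∫ s in (0 : ℝ)..t, g s :=
    fun ht => intervalIntegral.integral_congr fun s hs => by
      rw [Set.uIcc_of_le ht] at hs
      exact (hg s hs.1).symm
  refine ⟨hc, hgc, fun k t ht => ?_, fun k t ht => ?_⟩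
  · refine hasDerivAt_of_eq_integral (a := inner ℝ (b k) (ξ 0).fst) (f := fun t =>
      -lam k * (inner ℝ (b k) (ζ t).fst + inner ℝ (b k) (ζ t).snd)
        + inner ℝ (b k) (g t).fst) (by fun_prop) (fun t ht => ?_) ht
    have heq := congrArg (fstCoord b k) (h.equation t ht)
    rw [hgint ht, (fstCoord b k).apply_intervalIntegral hgc, map_add, map_sub,
      hA.fstCoord_jordanOperator] at heq
    have e1 := (fstCoord b k).apply_intervalIntegral hc t
    have e2 := (sndCoord b k).apply_intervalIntegral hc t
    rw [← hint ht] at e1 e2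
    simp only [fstCoord_apply, sndCoord_apply] at e1 e2 heq
    rw [e1, e2] at heq
    rw [intervalIntegral.integral_add (Continuous.intervalIntegrable (by fun_prop) _ _)
      (Continuous.intervalIntegrable (by fun_prop) _ _), intervalIntegral.integral_const_mul,
      intervalIntegral.integral_add (Continuous.intervalIntegrable (by fun_prop) _ _)
      (Continuous.intervalIntegrable (by fun_prop) _ _), hζ t ht]
    linarith
  · refine hasDerivAt_of_eq_integral (a := inner ℝ (b k) (ξ 0).snd) (f := fun t =>
      -lam k * inner ℝ (b k) (ζ t).snd
        + inner ℝ (b k) (g t).snd) (by fun_prop) (fun t ht => ?_) ht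
    have heq := congrArg (sndCoord b k) (h.equation t ht)
    rw [hgint ht, (sndCoord b k).apply_intervalIntegral hgc, map_add, map_sub,
      hA.sndCoord_jordanOperator] at heq
    have e2 := (sndCoord b k).apply_intervalIntegral hc t
    rw [← hint ht] at e2
    simp only [sndCoord_apply] at e2 heq
    rw [e2] at heq
    rw [intervalIntegral.integral_add (Continuous.intervalIntegrable (by fun_prop) _ _)
      (Continuous.intervalIntegrable (by fun_prop) _ _), intervalIntegral.integral_const_mul, hζ t ht]
    linarith

/-- The integrated coordinate equations prescribe the coordinates that `A` must produce, so
maximality of the diagonal domain puts the integral of ξ in it. The first row controls only the sum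
of the two components; subtracting the second recovers the first. -/
theorem IsModalSolution.isMildSolution [CompleteSpace H] (hA : IsDiagonalIn A b lam)
    {F : PhaseSpace H → PhaseSpace H} {ξ : ℝ → PhaseSpace H}
    (h : IsModalSolution b lam ξ (fun t => F (ξ t))) :
    IsMildSolution (jordanOperator A) F ξ := by
  obtain ⟨g, hg⟩ : ∃ g : ℝ → PhaseSpace H, g = fun t => F (ξ t) := ⟨_, rfl⟩
  rw [← hg] at h
  have hc := h.continuous
  have hFc := h.continuous_source
  have key : ∀ t, 0 ≤ t → ∃ hmem : (∫ s in (0 : ℝ)..t, ξ s) ∈ (jordanOperator A).domain,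
      ξ t - ξ 0 + (jordanOperator A) ⟨∫ s in (0 : ℝ)..t, ξ s, hmem⟩
        = ∫ s in (0 : ℝ)..t, g s := by
    intro t ht
    set I := ∫ s in (0 : ℝ)..t, ξ s with hI
    set J := ∫ s in (0 : ℝ)..t, g s with hJ
    have e1 := fun k => (fstCoord b k).apply_intervalIntegral hc t
    have e2 := fun k => (sndCoord b k).apply_intervalIntegral hc t
    have e3 := fun k => (fstCoord b k).apply_intervalIntegral hFc t
    have e4 := fun k => (sndCoord b k).apply_intervalIntegral hFc t
    rw [← hI] at e1 e2
    rw [← hJ] at e3 e4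
    simp only [fstCoord_apply, sndCoord_apply] at e1 e2 e3 e4
    obtain ⟨h2, hA2⟩ := hA.maximal I.snd (J.snd - (ξ t).snd + (ξ 0).snd) fun k => by
      have := eq_integral_of_hasDerivAt (by fun_prop) (f := fun t => -lam k *
        inner ℝ (b k) (ξ t).snd + inner ℝ (b k) (g t).snd) (by fun_prop)
        (h.hasDerivAt_snd k) ht
      rw [intervalIntegral.integral_add (Continuous.intervalIntegrable (by fun_prop) _ _)
        (Continuous.intervalIntegrable (by fun_prop) _ _), intervalIntegral.integral_const_mul,
        ← e2, ← e4] at this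
      rw [inner_add_right, inner_sub_right]
      linarith
    obtain ⟨h1, hA1⟩ := hA.maximal (I.fst + I.snd) (J.fst - (ξ t).fst + (ξ 0).fst) fun k => by
      have := eq_integral_of_hasDerivAt (by fun_prop) (f := fun t => -lam k *
        (inner ℝ (b k) (ξ t).fst + inner ℝ (b k) (ξ t).snd) + inner ℝ (b k) (g t).fst)
        (by fun_prop) (h.hasDerivAt_fst k) ht
      rw [intervalIntegral.integral_add (Continuous.intervalIntegrable (by fun_prop) _ _)
        (Continuous.intervalIntegrable (by fun_prop) _ _), intervalIntegral.integral_const_mul,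
        intervalIntegral.integral_add (Continuous.intervalIntegrable (by fun_prop) _ _)
        (Continuous.intervalIntegrable (by fun_prop) _ _), ← e1, ← e2, ← e3] at this
      rw [inner_add_right, inner_add_right, inner_sub_right]
      linarith
    have h0 : I.fst ∈ A.domain := by
      have := A.domain.sub_mem h1 h2
      rwa [add_sub_cancel_right] at this
    have hsum : A ⟨I.fst, h0⟩ + A ⟨I.snd, h2⟩ = J.fst - (ξ t).fst + (ξ 0).fst := by
      rw [← A.map_add, ← hA1]
      rfl
    obtain ⟨hmem, hjordan⟩ := exists_jordanOperator_eq h0 h2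
    refine ⟨hmem, ?_⟩
    rw [hjordan, hsum, hA2]
    refine WithLp.ofLp_injective 2 (Prod.ext ?_ ?_)
    · change (ξ t).fst - (ξ 0).fst + (J.fst - (ξ t).fst + (ξ 0).fst) = J.fst
      abel
    · change (ξ t).snd - (ξ 0).snd + (J.snd - (ξ t).snd + (ξ 0).snd) = J.snd
      abel
  exact ⟨hc.continuousOn, fun t ht => (key t ht).1, fun t ht => by
    rw [← show g = fun t => F (ξ t) from hg]
    exact (key t ht).2⟩

end Spectral

/-! ### The diagonal quadratic form and the projection onto the base. -/

section ConeOperator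

variable {H : Type*} [NormedAddCommGroup H] [InnerProductSpace ℝ H]

/-- The linear equivalence of `prodSelf V` with `V × V`. -/
noncomputable def prodSelfEquiv (V : Submodule ℝ H) : prodSelf V ≃ₗ[ℝ] V × V where
  toFun x := (⟨(x : PhaseSpace H).fst, x.2.1⟩, ⟨(x : PhaseSpace H).snd, x.2.2⟩)
  map_add' _ _ := rfl
  map_smul' _ _ := rfl
  invFun y := ⟨WithLp.toLp 2 ((y.1 : H), (y.2 : H)), y.1.2, y.2.2⟩
  left_inv _ := rfl
  right_inv _ := rfl

instance finiteDimensional_prodSelf (V : Submodule ℝ H) [FiniteDimensional ℝ V] :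
    FiniteDimensional ℝ (prodSelf V) :=
  Module.Finite.equiv (prodSelfEquiv V).symm

theorem finrank_prodSelf (V : Submodule ℝ H) [FiniteDimensional ℝ V] :
    Module.finrank ℝ (prodSelf V) = 2 * Module.finrank ℝ V := by
  rw [(prodSelfEquiv V).finrank_eq, Module.finrank_prod, two_mul]

theorem finite_Iic_pnat (n : ℕ+) : (Set.Iic n).Finite :=
  Set.Finite.subset (Set.finite_Icc 1 n) fun _ hk => ⟨one_le, hk⟩

theorem finrank_span_Iic {e : ℕ+ → H} (he : Orthonormal ℝ e) (n : ℕ+) :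
    Module.finrank ℝ (Submodule.span ℝ (e '' Set.Iic n)) = n := by
  have hfin : Fintype (Set.Iic n) := (finite_Iic_pnat n).fintype
  have hli : LinearIndependent ℝ (fun k : Set.Iic n => e k) :=
    he.linearIndependent.comp _ Subtype.val_injective
  rw [Set.image_eq_range, finrank_span_eq_card hli]
  have h : Set.Iic n = ↑(Finset.Icc 1 n) := by
    ext k; simp
  rw [← Nat.card_eq_fintype_card, Nat.card_coe_set_eq, h, Set.ncard_coe_finset, PNat.card_Icc]
  simp

theorem finiteDimensional_span_Iic (e : ℕ+ → H) (n : ℕ+) :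
    FiniteDimensional ℝ (Submodule.span ℝ (e '' Set.Iic n)) :=
  FiniteDimensional.span_of_finite ℝ ((finite_Iic_pnat n).image e)

/-- The operator equal to `p` on `V` and to `q` on the orthogonal complement of `V`. -/
noncomputable def splitOperator (V : Submodule ℝ H) [V.HasOrthogonalProjection] (p q : ℝ) :
    H →L[ℝ] H :=
  p • V.starProjection + q • (ContinuousLinearMap.id ℝ H - V.starProjection)

section Split

variable (V : Submodule ℝ H) [V.HasOrthogonalProjection] (p q : ℝ)

theorem splitOperator_apply (x : H) :
    splitOperator V p q x = p • V.starProjection x + q • (x - V.starProjection x) := rfl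

variable {V} in
theorem splitOperator_of_mem {x : H} (hx : x ∈ V) : splitOperator V p q x = p • x := by
  rw [splitOperator_apply, Submodule.starProjection_eq_self_iff.2 hx, sub_self, smul_zero, add_zero]

variable {V} in
theorem splitOperator_of_mem_orthogonal {x : H} (hx : x ∈ Vᗮ) :
    splitOperator V p q x = q • x := by
  have : V.starProjection x = 0 := by
    rw [Submodule.starProjection_apply, Submodule.orthogonalProjectionOnto_eq_zero_iff.2 hx]; rfl
  rw [splitOperator_apply, this, smul_zero, zero_add, sub_zero]

theorem splitOperator_symm (x y : H) :
    inner ℝ (splitOperator V p q x) y = inner ℝ x (splitOperator V p q y) := by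
  simp only [splitOperator_apply, inner_add_left, inner_add_right, real_inner_smul_left,
    real_inner_smul_right, inner_sub_left, inner_sub_right,
    Submodule.inner_starProjection_left_eq_right]

/-- The block operator with diagonal entries `splitOperator V p q` and `splitOperator V p' q'`. -/
noncomputable def blockOperator (p q p' q' : ℝ) : PhaseSpace H →L[ℝ] PhaseSpace H :=
  (WithLp.prodContinuousLinearEquiv 2 ℝ H H).symm.toContinuousLinearMap.comp
    (((splitOperator V p q).prodMap (splitOperator V p' q')).comp
      (WithLp.prodContinuousLinearEquiv 2 ℝ H H).toContinuousLinearMap)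

variable (p' q' : ℝ)

theorem blockOperator_apply (x : PhaseSpace H) : blockOperator V p q p' q' x
    = WithLp.toLp 2 (splitOperator V p q x.fst, splitOperator V p' q' x.snd) := rfl

theorem inner_blockOperator (x y : PhaseSpace H) : inner ℝ (blockOperator V p q p' q' x) y
    = inner ℝ (splitOperator V p q x.fst) y.fst + inner ℝ (splitOperator V p' q' x.snd) y.snd := by
  rw [blockOperator_apply, WithLp.prod_inner_apply]
  rfl

theorem inner_blockOperator_right (x y : PhaseSpace H) : inner ℝ x (blockOperator V p q p' q' y)
    = inner ℝ x.fst (splitOperator V p q y.fst) + inner ℝ x.snd (splitOperator V p' q' y.snd) := by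
  rw [blockOperator_apply, WithLp.prod_inner_apply]
  rfl

omit [V.HasOrthogonalProjection] in
variable {V} in
theorem mem_orthogonal_prodSelf {x : PhaseSpace H} (hx : x ∈ (prodSelf V)ᗮ) :
    x.fst ∈ Vᗮ ∧ x.snd ∈ Vᗮ := by
  rw [Submodule.mem_orthogonal] at hx
  constructor
  · refine (Submodule.mem_orthogonal _ _).2 fun v hv => ?_
    have := hx (WithLp.toLp 2 (v, 0)) ⟨hv, V.zero_mem⟩
    rw [WithLp.prod_inner_apply] at this
    simpa using this
  · refine (Submodule.mem_orthogonal _ _).2 fun v hv => ?_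
    have := hx (WithLp.toLp 2 (0, v)) ⟨V.zero_mem, hv⟩
    rw [WithLp.prod_inner_apply] at this
    simpa using this

theorem isConeOperator_blockOperator {p q p' q' m : ℝ} (hm : 0 < m) (hp : p ≤ -m) (hp' : p' ≤ -m)
    (hq : m ≤ q) (hq' : m ≤ q') :
    IsConeOperator (prodSelf V) (blockOperator V p q p' q') m where
  symm x y := by
    rw [inner_blockOperator, inner_blockOperator_right, splitOperator_symm, splitOperator_symm]
  invariant x hx := by
    obtain ⟨h1, h2⟩ := mem_prodSelf.1 hx
    rw [blockOperator_apply, splitOperator_of_mem _ _ h1, splitOperator_of_mem _ _ h2]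
    exact ⟨V.smul_mem _ h1, V.smul_mem _ h2⟩
  pos := hm
  neg_on x hx := by
    have h1 : splitOperator V p q x.fst = p • x.fst := splitOperator_of_mem _ _ hx.1
    have h2 : splitOperator V p' q' x.snd = p' • x.snd := splitOperator_of_mem _ _ hx.2
    rw [coneForm, inner_blockOperator, h1, h2, real_inner_smul_left, real_inner_smul_left,
      real_inner_self_eq_norm_sq, real_inner_self_eq_norm_sq, WithLp.prod_norm_sq_eq_of_L2]
    have e1 := mul_le_mul_of_nonneg_right hp (sq_nonneg ‖x.fst‖)
    have e2 := mul_le_mul_of_nonneg_right hp' (sq_nonneg ‖x.snd‖)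
    rw [mul_add]
    exact add_le_add e1 e2
  pos_on x hx := by
    obtain ⟨hx1, hx2⟩ := mem_orthogonal_prodSelf hx
    rw [coneForm, inner_blockOperator, splitOperator_of_mem_orthogonal _ _ hx1,
      splitOperator_of_mem_orthogonal _ _ hx2, real_inner_smul_left, real_inner_smul_left,
      real_inner_self_eq_norm_sq, real_inner_self_eq_norm_sq, WithLp.prod_norm_sq_eq_of_L2]
    have e1 := mul_le_mul_of_nonneg_right hq (sq_nonneg ‖x.fst‖)
    have e2 := mul_le_mul_of_nonneg_right hq' (sq_nonneg ‖x.snd‖)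
    rw [mul_add]
    exact add_le_add e1 e2

end Split

theorem mem_orthogonal_span_image {ι : Type*} {e : ι → H} (he : Orthonormal ℝ e) {s : Set ι}
    {k : ι} (hk : k ∉ s) : e k ∈ (Submodule.span ℝ (e '' s))ᗮ := by
  rw [Submodule.mem_orthogonal']
  intro y hy
  induction hy using Submodule.span_induction with
  | mem x hx =>
    obtain ⟨j, hj, rfl⟩ := hx
    exact he.2 fun h => hk (h ▸ hj)
  | zero => exact inner_zero_right _
  | add x y _ _ hx hy => rw [inner_add_right, hx, hy, add_zero]
  | smul c x _ hx => rw [real_inner_smul_right, hx, mul_zero]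

variable {ι : Type*} (b : HilbertBasis ι ℝ H) (s : Set ι)
  [(Submodule.span ℝ (b '' s)).HasOrthogonalProjection]

theorem hasSum_inner_splitOperator [DecidablePred (· ∈ s)] (p q : ℝ) (x : H) :
    HasSum (fun k => (if k ∈ s then p else q) * inner ℝ (b k) x ^ 2)
      (inner ℝ (splitOperator (Submodule.span ℝ (b '' s)) p q x) x) := by
  refine (b.hasSum_inner_mul_inner _ x).congr_fun fun k => ?_
  rw [splitOperator_symm]
  split_ifs with hk
  · rw [splitOperator_of_mem _ _ (Submodule.subset_span (Set.mem_image_of_mem _ hk)),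
      real_inner_smul_right, real_inner_comm x]
    ring
  · rw [splitOperator_of_mem_orthogonal _ _ (mem_orthogonal_span_image b.orthonormal hk),
      real_inner_smul_right, real_inner_comm x]
    ring

/-- Bridge between the two descriptions of V: a bounded operator for the cone geometry, a weighted
sum over modes for the energy inequality. -/
theorem hasSum_coneForm_blockOperator [DecidablePred (· ∈ s)] (p q p' q' : ℝ)
    (x : PhaseSpace H) :
    HasSum (fun k => (if k ∈ s then p else q) * inner ℝ (b k) x.fst ^ 2
        + (if k ∈ s then p' else q') * inner ℝ (b k) x.snd ^ 2)
      (coneForm (blockOperator (Submodule.span ℝ (b '' s)) p q p' q') x) := by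
  rw [coneForm, inner_blockOperator]
  exact (hasSum_inner_splitOperator b s p q x.fst).add (hasSum_inner_splitOperator b s p' q' x.snd)

omit [(Submodule.span ℝ (b '' s)).HasOrthogonalProjection] in
/-- The projection onto the base is controlled by finitely many coordinates. -/
theorem norm_sq_starProjection_prodSelf (s : Finset ι) (V : Submodule ℝ H)
    (hV : V = Submodule.span ℝ (b '' (s : Set ι))) [(prodSelf V).HasOrthogonalProjection]
    (x : PhaseSpace H) :
    ‖(prodSelf V).starProjection x‖ ^ 2
      = ∑ k ∈ s, (inner ℝ (b k) x.fst ^ 2 + inner ℝ (b k) x.snd ^ 2) := by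
  have hfst : ∀ k (z : PhaseSpace H), inner ℝ (b k) z.fst
      = inner ℝ (WithLp.toLp 2 (b k, 0) : PhaseSpace H) z := fun k z => by
    rw [WithLp.prod_inner_apply]; simp
  have hsnd : ∀ k (z : PhaseSpace H), inner ℝ (b k) z.snd
      = inner ℝ (WithLp.toLp 2 (0, b k) : PhaseSpace H) z := fun k z => by
    rw [WithLp.prod_inner_apply]; simp
  have hin : ∀ z ∈ prodSelf V, inner ℝ z ((prodSelf V).starProjection x) = inner ℝ z x :=
    fun z hz => by
      rw [← Submodule.inner_starProjection_left_eq_right, Submodule.starProjection_eq_self_iff.2 hz]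
  have hmem : ∀ k ∈ s, b k ∈ V := fun k hk =>
    hV ▸ Submodule.subset_span (Set.mem_image_of_mem _ hk)
  obtain ⟨hP1, hP2⟩ := mem_prodSelf.1 (Submodule.starProjection_apply_mem (prodSelf V) x)
  have hout : ∀ k ∉ s, ∀ v ∈ V, inner ℝ (b k) v = 0 := fun k hk v hv =>
    (Submodule.mem_orthogonal' _ _).1 (mem_orthogonal_span_image b.orthonormal
      (s := (s : Set ι)) (by simpa using hk)) v (hV ▸ hv)
  have h := hasSum_phase_sq b ((prodSelf V).starProjection x)
  have h2 := hasSum_sum_of_ne_finset_zero (s := s) (L := .unconditional ι) (f := fun k =>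
    inner ℝ (b k) ((prodSelf V).starProjection x).fst ^ 2
      + inner ℝ (b k) ((prodSelf V).starProjection x).snd ^ 2) fun k hk => by
    rw [hout k hk _ hP1, hout k hk _ hP2]; norm_num
  rw [h.unique h2]
  refine Finset.sum_congr rfl fun k hk => ?_
  have h1 : WithLp.toLp 2 (b k, 0) ∈ prodSelf V := ⟨hmem k hk, V.zero_mem⟩
  have h2 : WithLp.toLp 2 (0, b k) ∈ prodSelf V := ⟨V.zero_mem, hmem k hk⟩
  rw [hfst, hsnd, hin _ h1, hin _ h2, ← hfst, ← hsnd]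

end ConeOperator

/-! ### The semigroup, its time-τ cone condition, and passage to continuous time. -/

section Flow

variable {H : Type*} [NormedAddCommGroup H] [InnerProductSpace ℝ H]
variable {ι : Type*}

/-- `t ↦ S t x` solves the semilinear equation in coordinates, with initial value `x`. -/
structure IsModalFlow (b : HilbertBasis ι ℝ H) (lam : ι → ℝ) (F : PhaseSpace H → PhaseSpace H)
    (S : ℝ → PhaseSpace H → PhaseSpace H) : Prop where
  initial : ∀ x, S 0 x = x
  solution : ∀ x, IsModalSolution b lam (fun t => S t x) (fun t => F (S t x))

theorem exists_isModalFlow [Countable ι] [CompleteSpace H] (b : HilbertBasis ι ℝ H) {lam : ι → ℝ}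
    (hlam : ∀ k, 0 ≤ lam k) {F : PhaseSpace H → PhaseSpace H} {L : NNReal}
    (hF : LipschitzWith L F) : ∃ S, IsModalFlow b lam F S := by
  choose ξ h0 hξ using fun x => exists_modal_solution b hlam hF x
  exact ⟨fun t x => ξ x t, h0, hξ⟩

namespace IsModalFlow

variable [Countable ι] {b : HilbertBasis ι ℝ H} {lam : ι → ℝ} {F : PhaseSpace H → PhaseSpace H}
  {S : ℝ → PhaseSpace H → PhaseSpace H} (hS : IsModalFlow b lam F S) (hlam : ∀ k, 0 ≤ lam k)
  {L : NNReal} (hF : LipschitzWith L F)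
include hS hlam hF

theorem isSolutionSemigroup [CompleteSpace H] {A : H →ₗ.[ℝ] H} (hA : IsDiagonalIn A b lam) :
    IsSolutionSemigroup (jordanOperator A) F S where
  initial := hS.initial
  solution x := (hS.solution x).isMildSolution hA
  unique ξ hξ t ht := by
    have hc : Continuous fun t => ξ (max t 0) :=
      hξ.continuousOn.comp_continuous (by fun_prop) fun t => le_max_right t 0
    have h1 := hξ.isModalSolution hA hc (hF.continuous.comp hc)
      (fun t ht => by rw [max_eq_left ht]) (fun t ht => by simp only [Function.comp, max_eq_left ht])
    have h2 := h1.eq_of_initial hlam hF (hS.solution (ξ 0))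
      (by rw [hS.initial, max_self]) ht
    rwa [max_eq_left ht] at h2

theorem add_apply {s t : ℝ} (ht : 0 ≤ t) (hs : 0 ≤ s) (x : PhaseSpace H) :
    S (t + s) x = S t (S s x) :=
  ((hS.solution x).shift hs).eq_of_initial hlam hF (hS.solution (S s x))
    (by rw [zero_add, hS.initial]) ht

theorem norm_sub_sq_le {t : ℝ} (ht : 0 ≤ t) (x y : PhaseSpace H) :
    ‖S t x - S t y‖ ^ 2 ≤ Real.exp ((1 + (L : ℝ) ^ 2) * t) * ‖x - y‖ ^ 2 := by
  have := (hS.solution x).norm_sub_sq_le hlam hF (hS.solution y) ht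
  rwa [hS.initial, hS.initial] at this

theorem norm_sub_le {t : ℝ} (ht : 0 ≤ t) (x y : PhaseSpace H) :
    ‖S t x - S t y‖ ≤ Real.exp ((1 + (L : ℝ) ^ 2) / 2 * t) * ‖x - y‖ := by
  refine abs_le_of_sq_le_sq' ?_ (by positivity) |>.2
  rw [mul_pow, ← Real.exp_nat_mul]
  refine (hS.norm_sub_sq_le hlam hF ht x y).trans_eq ?_
  congr 2
  push_cast
  ring

theorem exists_norm_le {t : ℝ} (ht : 0 ≤ t) : ∃ C, ∀ x, ‖S t x‖ ≤ C * (‖x‖ + 1) := by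
  refine ⟨Real.exp ((1 + (L : ℝ) ^ 2) / 2 * t) + ‖S t 0‖, fun x => ?_⟩
  have h1 : ‖S t x‖ ≤ ‖S t x - S t 0‖ + ‖S t 0‖ := by
    simpa using norm_add_le (S t x - S t 0) (S t 0)
  have h2 := hS.norm_sub_le hlam hF ht x 0
  rw [sub_zero] at h2
  have h3 := mul_nonneg (norm_nonneg (S t 0)) (norm_nonneg x)
  have h4 := Real.exp_pos ((1 + (L : ℝ) ^ 2) / 2 * t)
  linarith

theorem lipschitzWith {t : ℝ} (ht : 0 ≤ t) : ∃ K : NNReal, LipschitzWith K (S t) := by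
  refine ⟨(Real.exp ((1 + (L : ℝ) ^ 2) / 2 * t)).toNNReal,
    LipschitzWith.of_dist_le_mul fun x y => ?_⟩
  rw [Real.coe_toNNReal _ (Real.exp_pos _).le, dist_eq_norm, dist_eq_norm]
  exact hS.norm_sub_le hlam hF ht x y

theorem iterate_eq {τ : ℝ} (hτ : 0 ≤ τ) (k : ℕ) (x : PhaseSpace H) :
    (S τ)^[k] x = S (k * τ) x := by
  induction k with
  | zero => simp [hS.initial]
  | succ k ih =>
    rw [Function.iterate_succ_apply', ih, ← hS.add_apply hlam hF hτ (by positivity)]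
    congr 1
    push_cast
    ring

theorem comm {s t : ℝ} (ht : 0 ≤ t) (hs : 0 ≤ s) (x : PhaseSpace H) :
    S t (S s x) = S s (S t x) := by
  rw [← hS.add_apply hlam hF ht hs, ← hS.add_apply hlam hF hs ht, add_comm]

/-- The strong cone condition. -/
theorem strong_cone {θ c : ℝ} (hθ : 0 ≤ θ) (hLc : (L : ℝ) ≤ c) {p r : ι → ℝ}
    (hdiss : ∀ k, ModeDissipative (lam k) θ (p k) (r k) (c ^ 2)) {V : PhaseSpace H → ℝ}
    (hV : ∀ x : PhaseSpace H, HasSum (fun k => p k * inner ℝ (b k) x.fst ^ 2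
      + r k * inner ℝ (b k) x.snd ^ 2) (V x)) {τ : ℝ} (hτ : 0 ≤ τ) (x y : PhaseSpace H) :
    Real.exp (2 * θ * τ) * V (S τ x - S τ y)
        + (c ^ 2 - (L : ℝ) ^ 2) * (τ * Real.exp (-((1 + (L : ℝ) ^ 2) * τ)))
          * ‖S τ x - S τ y‖ ^ 2 ≤ V (x - y) := by
  have hδ := (hS.solution x).sub (hS.solution y)
  have h1 := hδ.energy hdiss hV hτ
  have hc := hδ.continuous
  have hgc := hδ.continuous_source
  simp only [hS.initial] at h1
  set δ : ℝ → PhaseSpace H := fun t => S t x - S t y with hδdef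
  set g : ℝ → PhaseSpace H := fun t => F (S t x) - F (S t y) with hgdef
  have hgL : ∀ s, ‖g s‖ ≤ L * ‖δ s‖ := fun s => hF.norm_sub_le _ _
  have hκ : 0 ≤ c ^ 2 - (L : ℝ) ^ 2 := by
    have : (0 : ℝ) ≤ L := L.2
    nlinarith
  have h2 : ∫ s in (0 : ℝ)..τ, Real.exp (2 * θ * s) * ‖g s‖ ^ 2
      ≤ (L : ℝ) ^ 2 * ∫ s in (0 : ℝ)..τ, Real.exp (2 * θ * s) * ‖δ s‖ ^ 2 := by
    rw [← intervalIntegral.integral_const_mul]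
    refine intervalIntegral.integral_mono_on hτ (Continuous.intervalIntegrable (by fun_prop) _ _)
      (Continuous.intervalIntegrable (by fun_prop) _ _) fun s _ => ?_
    have h3 : ‖g s‖ ^ 2 ≤ (L : ℝ) ^ 2 * ‖δ s‖ ^ 2 := by
      rw [← mul_pow]; gcongr; exact hgL s
    have := mul_le_mul_of_nonneg_left h3 (Real.exp_pos (2 * θ * s)).le
    linarith
  -- Converts the surplus (c² - L²)∫‖δ‖² into a multiple of the endpoint norm: continuous dependence
  -- from s to τ bounds ‖δ s‖ below by ‖δ τ‖.
  have h3 : τ * (Real.exp (-((1 + (L : ℝ) ^ 2) * τ)) * ‖δ τ‖ ^ 2)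
      ≤ ∫ s in (0 : ℝ)..τ, Real.exp (2 * θ * s) * ‖δ s‖ ^ 2 := by
    have e : ∫ _s in (0 : ℝ)..τ, Real.exp (-((1 + (L : ℝ) ^ 2) * τ)) * ‖δ τ‖ ^ 2
        = τ * (Real.exp (-((1 + (L : ℝ) ^ 2) * τ)) * ‖δ τ‖ ^ 2) := by
      rw [intervalIntegral.integral_const, sub_zero, smul_eq_mul]
    rw [← e]
    refine intervalIntegral.integral_mono_on hτ (Continuous.intervalIntegrable (by fun_prop) _ _)
      (Continuous.intervalIntegrable (by fun_prop) _ _) fun s hs => ?_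
    have h4 : ‖δ τ‖ ^ 2 ≤ Real.exp ((1 + (L : ℝ) ^ 2) * τ) * ‖δ s‖ ^ 2 := by
      have h5 := hS.norm_sub_sq_le hlam hF (sub_nonneg.2 hs.2) (S s x) (S s y)
      rw [← hS.add_apply hlam hF (sub_nonneg.2 hs.2) hs.1,
        ← hS.add_apply hlam hF (sub_nonneg.2 hs.2) hs.1, sub_add_cancel] at h5
      refine h5.trans (mul_le_mul_of_nonneg_right (Real.exp_le_exp.2 ?_) (sq_nonneg _))
      have := hs.1
      gcongr
      linarith
    have h6 : Real.exp (-((1 + (L : ℝ) ^ 2) * τ)) * ‖δ τ‖ ^ 2 ≤ ‖δ s‖ ^ 2 := by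
      have := mul_le_mul_of_nonneg_left h4 (Real.exp_pos (-((1 + (L : ℝ) ^ 2) * τ))).le
      rwa [← mul_assoc, ← Real.exp_add, neg_add_cancel, Real.exp_zero, one_mul] at this
    have h7 : 1 ≤ Real.exp (2 * θ * s) :=
      Real.one_le_exp (mul_nonneg (by positivity) hs.1)
    have h8 := mul_le_mul_of_nonneg_right h7 (sq_nonneg ‖δ s‖)
    linarith
  have h4 := mul_le_mul_of_nonneg_left h3 hκ
  change Real.exp (2 * θ * τ) * V (δ τ) + _ * ‖δ τ‖ ^ 2 ≤ _
  linarith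

/-- For bounded eigenvalues the coordinate equations have right sides bounded by a multiple of ‖x -
y‖, so over a short time these coordinates change by O(τ). On the finitely many base modes this
makes the time-τ map close to the identity. -/
theorem abs_coord_sub_le {Λ : ℝ} {k : ι} (hk : lam k ≤ Λ) {τ : ℝ} (hτ : 0 ≤ τ)
    (hτ1 : τ ≤ 1) (x y : PhaseSpace H) :
    |inner ℝ (b k) ((S τ x - S τ y) - (x - y)).fst|
        ≤ τ * ((2 * Λ + L) * Real.exp ((1 + (L : ℝ) ^ 2) / 2)) * ‖x - y‖ ∧
    |inner ℝ (b k) ((S τ x - S τ y) - (x - y)).snd|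
        ≤ τ * ((2 * Λ + L) * Real.exp ((1 + (L : ℝ) ^ 2) / 2)) * ‖x - y‖ := by
  have hδ := (hS.solution x).sub (hS.solution y)
  have hc := hδ.continuous
  have hgc := hδ.continuous_source
  have hd1 := hδ.hasDerivAt_fst k
  have hd2 := hδ.hasDerivAt_snd k
  have h0 : S 0 x - S 0 y = x - y := by rw [hS.initial, hS.initial]
  have hbound : ∀ s ∈ Set.Icc 0 τ, ‖S s x - S s y‖
      ≤ Real.exp ((1 + (L : ℝ) ^ 2) / 2) * ‖x - y‖ := fun s hs => by
    refine (hS.norm_sub_le hlam hF hs.1 x y).trans ?_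
    gcongr
    exact mul_le_of_le_one_right (by positivity) (hs.2.trans hτ1)
  have hgL : ∀ s, ‖F (S s x) - F (S s y)‖ ≤ L * ‖S s x - S s y‖ := fun s => hF.norm_sub_le _ _
  obtain ⟨δ, hδeq⟩ : ∃ δ : ℝ → PhaseSpace H, δ = fun t => S t x - S t y := ⟨_, rfl⟩
  obtain ⟨g, hgeq⟩ : ∃ g : ℝ → PhaseSpace H, g = fun t => F (S t x) - F (S t y) := ⟨_, rfl⟩
  have hδa : ∀ s, S s x - S s y = δ s := fun s => by rw [hδeq]
  have hga : ∀ s, F (S s x) - F (S s y) = g s := fun s => by rw [hgeq]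
  simp only [hδa, hga] at hc hgc hd1 hd2 h0 hbound hgL
  rw [hδa, ← h0]
  rw [← h0] at hbound
  have hb1 : ∀ z : H, |inner ℝ (b k) z| ≤ ‖z‖ := fun z => by
    have := abs_real_inner_le_norm (b k) z
    rwa [b.orthonormal.1 k, one_mul] at this
  have hn1 : ∀ z : PhaseSpace H, ‖z.fst‖ ≤ ‖z‖ := fun z => by
    refine abs_le_of_sq_le_sq' ?_ (norm_nonneg _) |>.2
    rw [WithLp.prod_norm_sq_eq_of_L2 z]
    exact le_add_of_nonneg_right (sq_nonneg _)
  have hn2 : ∀ z : PhaseSpace H, ‖z.snd‖ ≤ ‖z‖ := fun z => by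
    refine abs_le_of_sq_le_sq' ?_ (norm_nonneg _) |>.2
    rw [WithLp.prod_norm_sq_eq_of_L2 z]
    exact le_add_of_nonneg_left (sq_nonneg _)
  have hΛ : 0 ≤ Λ := (hlam k).trans hk
  have hL0 : (0 : ℝ) ≤ L := L.2
  set E := Real.exp ((1 + (L : ℝ) ^ 2) / 2)
  have hrhs : ∀ s ∈ Set.Icc 0 τ, 2 * (lam k * ‖δ s‖) + ‖g s‖ ≤ (2 * Λ + L) * (E * ‖δ 0‖) :=
    fun s hs => by
      have h1 := mul_le_mul hk (hbound s hs) (norm_nonneg _) hΛ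
      have h2 := (hgL s).trans (mul_le_mul_of_nonneg_left (hbound s hs) hL0)
      linarith
  constructor
  · rw [WithLp.sub_fst, inner_sub_right, eq_integral_of_hasDerivAt (by fun_prop)
      (f := fun t => -lam k * (inner ℝ (b k) (δ t).fst + inner ℝ (b k) (δ t).snd)
        + inner ℝ (b k) (g t).fst) (by fun_prop) hd1 hτ]
    have := intervalIntegral.norm_integral_le_of_norm_le_const (a := 0) (b := τ)
      (C := (2 * Λ + L) * (E * ‖δ 0‖)) (f := fun t => -lam k * (inner ℝ (b k) (δ t).fst
        + inner ℝ (b k) (δ t).snd) + inner ℝ (b k) (g t).fst) fun s hs => by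
      rw [Set.uIoc_of_le hτ] at hs
      refine le_trans ?_ (hrhs s ⟨hs.1.le, hs.2⟩)
      rw [Real.norm_eq_abs]
      refine (abs_add_le _ _).trans (add_le_add ?_ ((hb1 _).trans (hn1 _)))
      rw [abs_mul, abs_neg, abs_of_nonneg (hlam k)]
      have h1 := (abs_add_le (inner ℝ (b k) (δ s).fst) (inner ℝ (b k) (δ s).snd)).trans
        (add_le_add ((hb1 _).trans (hn1 (δ s))) ((hb1 _).trans (hn2 (δ s))))
      have h2 := mul_le_mul_of_nonneg_left h1 (hlam k)
      linarith
    rw [sub_zero, abs_of_nonneg hτ, Real.norm_eq_abs] at this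
    linarith
  · rw [WithLp.sub_snd, inner_sub_right, eq_integral_of_hasDerivAt (by fun_prop)
      (f := fun t => -lam k * inner ℝ (b k) (δ t).snd + inner ℝ (b k) (g t).snd)
      (by fun_prop) hd2 hτ]
    have := intervalIntegral.norm_integral_le_of_norm_le_const (a := 0) (b := τ)
      (C := (2 * Λ + L) * (E * ‖δ 0‖)) (f := fun t => -lam k * inner ℝ (b k) (δ t).snd
        + inner ℝ (b k) (g t).snd) fun s hs => by
      rw [Set.uIoc_of_le hτ] at hs
      refine le_trans ?_ (hrhs s ⟨hs.1.le, hs.2⟩)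
      rw [Real.norm_eq_abs]
      refine (abs_add_le _ _).trans (add_le_add ?_ ((hb1 _).trans (hn2 _)))
      rw [abs_mul, abs_neg, abs_of_nonneg (hlam k)]
      have h1 := (hb1 _).trans (hn2 (δ s))
      have h2 := mul_le_mul_of_nonneg_left h1 (hlam k)
      have h3 := mul_nonneg (hlam k) (norm_nonneg (δ s))
      linarith
    rw [sub_zero, abs_of_nonneg hτ, Real.norm_eq_abs] at this
    linarith

theorem norm_starProjection_sub_le {Λ : ℝ} (hΛ : 0 ≤ Λ) (s : Finset ι) (hs : ∀ k ∈ s, lam k ≤ Λ)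
    (V : Submodule ℝ H) (hV : V = Submodule.span ℝ (b '' (s : Set ι)))
    [(prodSelf V).HasOrthogonalProjection] {τ : ℝ} (hτ : 0 ≤ τ) (hτ1 : τ ≤ 1)
    (x y : PhaseSpace H) :
    ‖(prodSelf V).starProjection (S τ x - S τ y) - (prodSelf V).starProjection (x - y)‖
      ≤ τ * (Real.sqrt (2 * s.card) * ((2 * Λ + L) * Real.exp ((1 + (L : ℝ) ^ 2) / 2)))
        * ‖x - y‖ := by
  rw [← map_sub]
  have hL0 : (0 : ℝ) ≤ L := L.2
  refine abs_le_of_sq_le_sq' ?_ (by positivity) |>.2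
  rw [norm_sq_starProjection_prodSelf b s V hV]
  set B := τ * ((2 * Λ + L) * Real.exp ((1 + (L : ℝ) ^ 2) / 2)) * ‖x - y‖
  have hle : ∀ k ∈ s, inner ℝ (b k) ((S τ x - S τ y) - (x - y)).fst ^ 2
      + inner ℝ (b k) ((S τ x - S τ y) - (x - y)).snd ^ 2 ≤ 2 * B ^ 2 := fun k hk => by
    obtain ⟨h1, h2⟩ := hS.abs_coord_sub_le hlam hF (hs k hk) hτ hτ1 x y
    have e1 := sq_le_sq' (neg_le_of_abs_le h1) (le_of_abs_le h1)
    have e2 := sq_le_sq' (neg_le_of_abs_le h2) (le_of_abs_le h2)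
    linarith
  refine (Finset.sum_le_card_nsmul _ _ _ hle).trans_eq ?_
  have e : τ * (Real.sqrt (2 * s.card) * ((2 * Λ + L) * Real.exp ((1 + (L : ℝ) ^ 2) / 2)))
      * ‖x - y‖ = Real.sqrt (2 * s.card) * B := by ring
  rw [e, mul_pow (Real.sqrt _), Real.sq_sqrt (by positivity), nsmul_eq_mul]
  ring

omit [Countable ι] hS hlam hF in
theorem exists_small_time {D : ℝ} (hD : 0 ≤ D) : ∃ τ : ℝ, 0 < τ ∧ τ ≤ 1 ∧ τ * D < 1 := by
  refine ⟨1 / (1 + D), by positivity, ?_, ?_⟩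
  · rw [div_le_one (by positivity)]; linarith
  · rw [div_mul_eq_mul_div, one_mul, div_lt_one (by positivity)]; linarith

/-- A time-`τ` cone map produces an inertial manifold. -/
theorem isInertialManifold [CompleteSpace H] {A : H →ₗ.[ℝ] H} (hA : IsDiagonalIn A b lam)
    {P : Submodule ℝ (PhaseSpace H)} [FiniteDimensional ℝ P]
    {T : PhaseSpace H →L[ℝ] PhaseSpace H} {m κ θ τ : ℝ} (hθ : 0 < θ) (hτ : 0 < τ)
    (hf : IsConeMap P T m (Real.exp (2 * θ * τ)) κ (S τ)) :
    IsInertialManifold (jordanOperator A) F S P θ (slowSet (S τ) (Real.exp (2 * θ * τ))) := by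
  set μ := Real.exp (2 * θ * τ) with hμ
  have hμ0 : 0 < μ := Real.exp_pos _
  have hmaps : ∀ t, 0 ≤ t → ∀ x ∈ slowSet (S τ) μ, S t x ∈ slowSet (S τ) μ := fun t ht x hx => by
    obtain ⟨C, hC⟩ := hS.exists_norm_le hlam hF ht
    exact IsConeMap.map_mem_slowSet hf.one_lt (fun x => hS.comm hlam hF hτ.le ht x) hC hx
  have hsemi := hS.isSolutionSemigroup hlam hF hA
  refine ⟨hf.isClosed_slowSet, fun t ht => ?_, hf.exists_lipschitz_graph, hθ, ?_⟩
  · refine Set.Subset.antisymm (Set.image_subset_iff.2 (hmaps t ht)) fun x hx => ?_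
    -- Pulling x back by kτ ≥ t and flowing forward for kτ - t yields a preimage under the flow at
    -- time t.
    obtain ⟨k, hk⟩ := exists_nat_ge (t / τ)
    rw [div_le_iff₀ hτ] at hk
    obtain ⟨y, hy, rfl⟩ := IsConeMap.exists_backward_mem_slowSet hx k hμ0
    refine ⟨S (k * τ - t) y, hmaps _ (by linarith) y hy, ?_⟩
    rw [hS.iterate_eq hlam hF hτ.le, ← hS.add_apply hlam hF ht (by linarith)]
    congr 1
    ring
  · obtain ⟨C, hC0, hC⟩ := hf.exists_tracking
    set B := Real.sqrt (Real.exp ((1 + (L : ℝ) ^ 2) * τ) * (μ * C))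
    refine ⟨fun r => B * (r + 1), fun r r' h =>
      mul_le_mul_of_nonneg_left (by linarith) (Real.sqrt_nonneg _), fun ξ hξ => ?_⟩
    obtain ⟨w, hw, htrack⟩ := hC (ξ 0)
    refine ⟨fun t => S t w, hsemi.solution w, fun t ht => hmaps t ht w hw, fun t ht => ?_⟩
    rw [hsemi.unique ξ hξ t ht]
    set k := ⌊t / τ⌋₊
    have hk1 : k * τ ≤ t := (le_div_iff₀ hτ).1 (Nat.floor_le (by positivity))
    have hk2 : t < (k + 1) * τ := (div_lt_iff₀ hτ).1 (Nat.lt_floor_add_one _)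
    have e : ∀ x, S t x = S (t - k * τ) ((S τ)^[k] x) := fun x => by
      rw [hS.iterate_eq hlam hF hτ.le, ← hS.add_apply hlam hF (by linarith) (by positivity),
        sub_add_cancel]
    refine abs_le_of_sq_le_sq' ?_ (by positivity) |>.2
    have h1 := hS.norm_sub_sq_le hlam hF (sub_nonneg.2 hk1) ((S τ)^[k] (ξ 0)) ((S τ)^[k] w)
    rw [← e, ← e] at h1
    have h2 : Real.exp ((1 + (L : ℝ) ^ 2) * (t - k * τ)) ≤ Real.exp ((1 + (L : ℝ) ^ 2) * τ) := by
      refine Real.exp_le_exp.2 (mul_le_mul_of_nonneg_left ?_ (by positivity))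
      linarith
    have h3 : ‖(S τ)^[k] (ξ 0) - (S τ)^[k] w‖ ^ 2
        ≤ Real.exp (-θ * t) ^ 2 * (μ * (C * (‖ξ 0‖ + 1) ^ 2)) := by
      -- The extra factor μ compensates for rounding t down to kτ, as t < (k + 1)τ.
      have h4 : 1 ≤ Real.exp (-θ * t) ^ 2 * μ * μ ^ k := by
        rw [hμ, ← Real.exp_nat_mul, ← Real.exp_nat_mul, ← Real.exp_add, ← Real.exp_add]
        refine Real.one_le_exp ?_
        push_cast
        nlinarith
      calc ‖(S τ)^[k] (ξ 0) - (S τ)^[k] w‖ ^ 2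
          ≤ Real.exp (-θ * t) ^ 2 * μ * μ ^ k * ‖(S τ)^[k] (ξ 0) - (S τ)^[k] w‖ ^ 2 :=
            le_mul_of_one_le_left (sq_nonneg _) h4
        _ = Real.exp (-θ * t) ^ 2 * (μ * (μ ^ k * ‖(S τ)^[k] (ξ 0) - (S τ)^[k] w‖ ^ 2)) := by ring
        _ ≤ _ := mul_le_mul_of_nonneg_left
            (mul_le_mul_of_nonneg_left (htrack k) hμ0.le) (sq_nonneg _)
    rw [mul_pow, mul_pow, Real.sq_sqrt (by positivity)]
    calc _ ≤ Real.exp ((1 + (L : ℝ) ^ 2) * (t - k * τ))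
          * ‖(S τ)^[k] (ξ 0) - (S τ)^[k] w‖ ^ 2 := h1
      _ ≤ Real.exp ((1 + (L : ℝ) ^ 2) * τ)
          * (Real.exp (-θ * t) ^ 2 * (μ * (C * (‖ξ 0‖ + 1) ^ 2))) :=
        mul_le_mul h2 h3 (sq_nonneg _) (Real.exp_pos _).le
      _ = _ := by ring

end IsModalFlow

end Flow

/-! ### Choice of the form and of the time step. -/

theorem theorem3p1 {H : Type*} [NormedAddCommGroup H] [InnerProductSpace ℝ H] [CompleteSpace H]
    (A : H →ₗ.[ℝ] H) (hsa : IsSelfAdjoint A)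
    (hpos : ∀ x : A.domain, x ≠ 0 → 0 < inner ℝ (A x) (x : H))
    (hcomp : HasCompactInverse A)
    (lam : ℕ+ → ℝ) (e : ℕ+ → H) (henum : IsEigenEnumeration A lam e)
    (F : PhaseSpace H → PhaseSpace H) (L : NNReal) (hF : LipschitzWith L F)
    (n : ℕ+)
    (hgap : (L : ℝ) < (lam (n + 1) - lam n) ^ 2 /
      (lam (n + 1) + lam n
        + 2 * Real.sqrt (lam (n + 1) ^ 2 - lam n * lam (n + 1) + lam n ^ 2))) :
    Module.finrank ℝ (baseSpace e n) = 2 * (n : ℕ) ∧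
    ∃ S : ℝ → PhaseSpace H → PhaseSpace H,
      IsSolutionSemigroup (jordanOperator A) F S ∧
      ∃ W : Set (PhaseSpace H),
        IsInertialManifold (jordanOperator A) F S (baseSpace e n)
          (2 / 3 * (lam (n + 1) + lam n)
            - 1 / 3 * Real.sqrt (lam (n + 1) ^ 2 - lam n * lam (n + 1) + lam n ^ 2)) W := by
  have hlam := henum.pos hpos
  have hlam0 : ∀ k, 0 ≤ lam k := fun k => (hlam k).le
  have hL0 : (0 : ℝ) ≤ L := L.2
  obtain ⟨b, hb, hA⟩ := henum.exists_hilbertBasis hsa hcomp hlam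
  obtain rfl : (b : ℕ+ → H) = e := funext hb
  have hfin := finiteDimensional_span_Iic (b : ℕ+ → H) n
  refine ⟨by rw [baseSpace, finrank_prodSelf, finrank_span_Iic henum.orthonormal], ?_⟩
  obtain ⟨c, θ, hθ, hLc, hθ0, haθ, hθb, hα, hβ⟩ := exists_gap_constant (hlam n)
    (henum.monotone (PNat.lt_add_right n 1).le) hL0 hgap
  rw [← hθ]
  obtain ⟨S, hS⟩ := exists_isModalFlow b hlam0 hF
  refine ⟨S, hS.isSolutionSemigroup hlam0 hF hA, ?_⟩
  have hc : 0 < c := hL0.trans_lt hLc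
  set V := Submodule.span ℝ (b '' Set.Iic n) with hV
  set α := lam (n + 1) - θ with hαdef
  set β := θ - lam n with hβdef
  have hα0 : 0 < α := sub_pos.2 hθb
  have hβ0 : 0 < β := sub_pos.2 haθ
  set m := min (min (c ^ 2 / β) β) (min (c ^ 2 / α) α) with hmdef
  have hm : 0 < m := by positivity
  set T := blockOperator V (-(c ^ 2 / β)) (c ^ 2 / α) (-β) α with hTdef
  have hT : IsConeOperator (prodSelf V) T m := isConeOperator_blockOperator V hm
    (neg_le_neg ((min_le_left _ _).trans (min_le_left _ _)))
    (neg_le_neg ((min_le_left _ _).trans (min_le_right _ _)))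
    ((min_le_right _ _).trans (min_le_left _ _)) ((min_le_right _ _).trans (min_le_right _ _))
  have hdiss : ∀ k, ModeDissipative (lam k) θ
      (if k ∈ Set.Iic n then -(c ^ 2 / β) else c ^ 2 / α)
      (if k ∈ Set.Iic n then -β else α) (c ^ 2) := fun k => by
    split_ifs with hk
    · exact modeDissipative_low hc haθ (hlam0 k) hβ (henum.monotone hk)
    · exact modeDissipative_high hc hθb (hlam (n + 1)) hα
        (henum.monotone (PNat.add_one_le_iff.2 (not_le.1 hk)))
  have hVs : V = Submodule.span ℝ (b '' ((Finset.Icc 1 n : Finset ℕ+) : Set ℕ+)) := by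
    rw [hV]
    congr 2
    ext k
    simp
  set D := Real.sqrt (2 * (Finset.Icc 1 n : Finset ℕ+).card)
    * ((2 * lam n + L) * Real.exp ((1 + (L : ℝ) ^ 2) / 2)) with hDdef
  have hD0 : 0 ≤ D := by have := hlam0 n; positivity
  -- The cone condition holds for every τ > 0. Only solvability of P f(G z) = p needs τ small,
  -- namely τD√(1 + ‖T‖/m) < 1.
  obtain ⟨τ, hτ0, hτ1, hτ⟩ := IsModalFlow.exists_small_time
    (mul_nonneg hD0 (Real.sqrt_nonneg (1 + ‖T‖ / m)))
  have hκ : 0 < c ^ 2 - (L : ℝ) ^ 2 := by nlinarith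
  have hmap : IsConeMap (prodSelf V) T m (Real.exp (2 * θ * τ))
      ((c ^ 2 - (L : ℝ) ^ 2) * (τ * Real.exp (-((1 + (L : ℝ) ^ 2) * τ)))) (S τ) :=
    { cone := hT
      one_lt := Real.one_lt_exp_iff.2 (by positivity)
      gain_pos := by positivity
      lipschitz := hS.lipschitzWith hlam0 hF hτ0.le
      strong_cone := hS.strong_cone hlam0 hF hθ0.le hLc.le hdiss
        (hasSum_coneForm_blockOperator b (Set.Iic n) _ _ _ _) hτ0.le
      near_id := ⟨τ * D, by positivity, by rwa [mul_assoc],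
        hS.norm_starProjection_sub_le hlam0 hF (hlam0 n) (Finset.Icc 1 n)
          (fun k hk => henum.monotone (Finset.mem_Icc.1 hk).2) V hVs hτ0.le hτ1⟩ }
  exact ⟨_, hS.isInertialManifold (P := prodSelf V) hlam0 hF hA hθ0 hτ0 hmap⟩
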